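/- Let $S$ be a cancellative monoid with group of units $S^*$. Assume that $S$ is right LCM, i.e. for all $p,q\in S$ the set $pS\cap qS$ is either empty or of the form $rS$ for some $r\in S$, and that $S$ satisfies (C1): $aS^*\subseteq S^*a$ for all $a\in S$. Then $a\sim b :\Leftrightarrow a=xb$ for some $x\in S^*$ is a congruence on $S$; assume that the quotient monoid $\mathcal S=S/{\sim}$ embeds into a group $\Gamma$ which is generated by the image of $\mathcal S$. Let $\mathcal J(S)$ be the set of constructible right ideals of $S$, i.e. the smallest family of subsets of $S$ that contains $\emptyset$ and $S$ and is closed under $X\mapsto pX$ and $X\mapsto p^{-1}X=\{y\in S: py\in X\}$ for $p\in S$. Let $C^*(S)$ be the full semigroup $C^*$-algebra of $S$: the universal unital $C^*$-algebra generated by isometries $(v_p)_{p\in S}$ and projections $(e_X)_{X\in\mathcal J(S)}$ with $v_pv_q=v_{pq}$, $v_pe_Xv_p^*=e_{pX}$, $e_\emptyset=0$, $e_S=1$ and $e_Xe_Y=e_{X\cap Y}$ for all $p,q\in S$ and $X,Y\in\mathcal J(S)$. Put $$\mathcal D=C^*(\{e_X: X\in\mathcal J(S)\}),\qquad \mathcal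 C_I=C^*(\{e_{pS},v_x: p\in S,\ x\in S^*\}),$$ so that $\mathcal D\subseteq\mathcal C_I\subseteq C^*(S)$. The embedding of $\mathcal S$ into $\Gamma$ gives rise to a conditional expectation $\Phi_{\mathcal C_I}:C^*(S)\to\mathcal C_I$ such that, for $p,q\in S$, $\Phi_{\mathcal C_I}(v_pv_q^*)=v_xe_{qS}$ if $p=xq$ for some $x\in S^*$, and $\Phi_{\mathcal C_I}(v_pv_q^*)=0$ if $p\not\sim q$. Assume that $\Phi_{\mathcal C_I}$ is faithful on positive elements, and that there is a conditional expectation $\Phi_0$ from $\mathcal C_I$ onto $\mathcal D$, faithful on positive elements, such that $\Phi_0(e_{qS}v_x)=\delta_{x,1_S}\,e_{qS}$ for all $q\in S$ and $x\in S^*$. Then a $*$-homomorphism $\pi:C^*(S)\to B$ into a $C^*$-algebra $B$ is injective if and only if its restriction $\pi|_{\mathcal C_I}$ is injective. -/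

import Mathlib

open scoped ENNReal InnerProductSpace

universe u v w

namespace RightLCM

/-! ## Semigroups -/

/-- The principal right ideal `pS`. -/
def principalIdeal {S : Type u} [Mul S] (p : S) : Set S := Set.range fun s => p * s

/-- A left cancellative semigroup is right LCM if any two principal right ideals are either
disjoint or intersect in a principal right ideal, i.e. if every two elements with a right common
multiple have a right least common multiple. -/
def IsRightLCM (S : Type u) [Mul S] [IsLeftCancelMul S] : Prop :=
  ∀ p q : S, (principalIdeal p ∩ principalIdeal q).Nonempty →
    ∃ r : S, principalIdeal p ∩ principalIdeal q = principalIdeal r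

/-- The constructible right ideals: the smallest family containing `∅` and `S` which is closed
under `X ↦ pX` and `X ↦ p⁻¹X = {y | p * y ∈ X}`. -/
inductive IsConstructible {S : Type u} [Mul S] : Set S → Prop
  | empty : IsConstructible ∅
  | univ : IsConstructible Set.univ
  | image (p : S) {X : Set S} : IsConstructible X → IsConstructible ((fun s => p * s) '' X)
  | preimage (p : S) {X : Set S} : IsConstructible X → IsConstructible ((fun s => p * s) ⁻¹' X)

theorem IsConstructible.inter {S : Type u} [Mul S] [IsLeftCancelMul S] {X Y : Set S}
    (hX : IsConstructible X) (hY : IsConstructible Y) : IsConstructible (X ∩ Y) := by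
  induction hX generalizing Y with
  | empty => simpa using IsConstructible.empty
  | univ => simpa using hY
  | image p _ ih =>
    rw [← Set.image_inter_preimage]
    exact .image p (ih (.preimage p hY))
  | @preimage p X _ ih =>
    have h := IsConstructible.preimage p (ih (.image p hY))
    rwa [Set.preimage_inter, Set.preimage_image_eq _ (mul_right_injective p)] at h

/-- The set `𝒥(S)` of constructible right ideals. -/
def ConstructibleIdeal (S : Type u) [Mul S] : Type u := {X : Set S // IsConstructible X}

namespace ConstructibleIdeal

variable {S : Type u}

protected def empty [Mul S] : ConstructibleIdeal S := ⟨∅, .empty⟩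

protected def univ [Mul S] : ConstructibleIdeal S := ⟨Set.univ, .univ⟩

/-- `pX`. -/
def translate [Mul S] (p : S) (X : ConstructibleIdeal S) : ConstructibleIdeal S :=
  ⟨(fun s => p * s) '' X.1, .image p X.2⟩

protected def inter [Mul S] [IsLeftCancelMul S] (X Y : ConstructibleIdeal S) :
    ConstructibleIdeal S := ⟨X.1 ∩ Y.1, X.2.inter Y.2⟩

/-- `pS` as a constructible right ideal. -/
def principal [Mul S] (p : S) : ConstructibleIdeal S :=
  ⟨principalIdeal p, by
    have h := IsConstructible.image p IsConstructible.univ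
    rwa [Set.image_univ] at h⟩

end ConstructibleIdeal

/-- Condition (C1): `aS* ⊆ S*a` for all `a`. -/
def SatisfiesC1 (S : Type u) [Monoid S] : Prop :=
  ∀ (a : S) (x : Sˣ), ∃ y : Sˣ, a * x = y * a

/-- The congruence `a ∼ b ↔ ∃ x ∈ S*, a = x b` of a monoid with (C1). -/
def unitCongruence {S : Type u} [Monoid S] (hC1 : SatisfiesC1 S) : Con S where
  r a b := ∃ x : Sˣ, a = x * b
  iseqv :=
    { refl := fun a => ⟨1, by simp⟩
      symm := by
        rintro a b ⟨x, rfl⟩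
        exact ⟨x⁻¹, by simp⟩
      trans := by
        rintro a b c ⟨x, rfl⟩ ⟨y, rfl⟩
        exact ⟨x * y, by simp [mul_assoc]⟩ }
  mul' := by
    rintro a b c d ⟨x, rfl⟩ ⟨y, rfl⟩
    obtain ⟨z, hz⟩ := hC1 b y
    exact ⟨x * z, by rw [mul_assoc, ← mul_assoc b, hz]; simp [mul_assoc]⟩

/-- The monoid `𝒮 = S/∼`. -/
abbrev UnitQuotient {S : Type u} [Monoid S] (hC1 : SatisfiesC1 S) : Type u :=
  (unitCongruence hC1).Quotient

/-! ## The full semigroup C*-algebra -/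

/-- A family of isometries `v p`, `p ∈ S`, and projections `e X`, `X ∈ 𝒥(S)`, in a unital
`*`-ring which satisfies the defining relations (L1)-(L4) of the full semigroup C*-algebra. -/
structure LiFamily (S : Type u) [Monoid S] [IsLeftCancelMul S] (A : Type w) [Ring A] [StarRing A]
    where
  v : S → A
  e : ConstructibleIdeal S → A
  isometry : ∀ p, star (v p) * v p = 1
  projection : ∀ X, IsStarProjection (e X)
  v_mul : ∀ p q, v p * v q = v (p * q)
  conj : ∀ p X, v p * e X * star (v p) = e (X.translate p)
  e_empty : e .empty = 0
  e_univ : e .univ = 1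
  e_mul : ∀ X Y, e X * e Y = e (X.inter Y)

/-- A representation of the relations (L1)-(L4) by operators on a non-zero complex Hilbert
space. -/
structure LiRepresentation (S : Type u) [Monoid S] [IsLeftCancelMul S] : Type (u + 1) where
  H : Type u
  [normed : NormedAddCommGroup H]
  [inner : InnerProductSpace ℂ H]
  [complete : CompleteSpace H]
  [nontrivial : Nontrivial H]
  family : LiFamily S (H →L[ℂ] H)

attribute [instance] LiRepresentation.normed LiRepresentation.inner LiRepresentation.complete
  LiRepresentation.nontrivial

noncomputable section

section FullAlgebra

variable (S : Type u) [Monoid S] [IsLeftCancelMul S]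

/-- The `ℓ^∞`-product of the C*-algebras `B(H_ρ)` over all representations `ρ` of the relations
(L1)-(L4) on Hilbert spaces. -/
abbrev RepProduct : Type (u + 1) :=
  lp (fun ρ : LiRepresentation S => ρ.H →L[ℂ] ρ.H) ∞

instance : CStarAlgebra (RepProduct S) where

variable {S}

theorem LiFamily.norm_v_le {A : Type w} [CStarAlgebra A] (F : LiFamily S A) (p : S) :
    ‖F.v p‖ ≤ 1 := by
  have h : ‖F.v p‖ * ‖F.v p‖ = ‖(1 : A)‖ := by
    rw [← CStarRing.norm_star_mul_self, F.isometry]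
  rcases subsingleton_or_nontrivial A with hA | hA
  · simp [Subsingleton.elim (F.v p) 0]
  · rw [CStarRing.norm_one] at h
    nlinarith [norm_nonneg (F.v p)]

/-- The universal isometries, as elements of the product: the `ρ`-th coordinate is `ρ(v_p)`. -/
def prodV (p : S) : RepProduct S :=
  ⟨fun ρ => ρ.family.v p, memℓp_infty ⟨1, by
    rintro _ ⟨ρ, rfl⟩
    exact ρ.family.norm_v_le p⟩⟩

/-- The universal projections, as elements of the product: the `ρ`-th coordinate is `ρ(e_X)`. -/
def prodE (X : ConstructibleIdeal S) : RepProduct S :=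
  ⟨fun ρ => ρ.family.e X, memℓp_infty ⟨1, by
    rintro _ ⟨ρ, rfl⟩
    exact (ρ.family.projection X).norm_le⟩⟩

variable (S)

/-- The full semigroup C*-algebra `C*(S)`: the universal unital C*-algebra generated by isometries
`v_p` and projections `e_X` subject to (L1)-(L4). It is realized as the C*-algebra generated by the
universal family in the product over all Hilbert space representations of the relations, so that
its norm is the supremum over all these representations, and each representation `ρ` of the
relations extends to it, by projecting to the `ρ`-th coordinate (see `extend`). Hilbert spaces in
the universe of `S` suffice: a cyclic representation acts on a space whose density is at most
`max |S| ℵ₀`. -/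
def fullAlgebra : StarSubalgebra ℂ (RepProduct S) :=
  (StarAlgebra.adjoin ℂ (Set.range (prodV (S := S)) ∪ Set.range (prodE (S := S)))).topologicalClosure

instance : IsClosed (fullAlgebra S : Set (RepProduct S)) :=
  StarSubalgebra.isClosed_topologicalClosure _

/-- `C*(S)` as a type. -/
def FullCStar : Type (u + 1) := fullAlgebra S

instance : CStarAlgebra (FullCStar S) := inferInstanceAs (CStarAlgebra (fullAlgebra S))

/-- The inclusion of `C*(S)` into the product over all representations. -/
def toProduct : FullCStar S →⋆ₐ[ℂ] RepProduct S := (fullAlgebra S).subtype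

theorem isometry_toProduct : Isometry (toProduct S) := isometry_subtype_coe

variable {S}

/-- The generating isometry `v_p` of `C*(S)`. -/
def isom (p : S) : FullCStar S :=
  ⟨prodV p, StarSubalgebra.le_topologicalClosure _
    (StarAlgebra.subset_adjoin ℂ _ (Or.inl ⟨p, rfl⟩))⟩

/-- The generating projection `e_X` of `C*(S)`. -/
def proj (X : ConstructibleIdeal S) : FullCStar S :=
  ⟨prodE X, StarSubalgebra.le_topologicalClosure _
    (StarAlgebra.subset_adjoin ℂ _ (Or.inr ⟨X, rfl⟩))⟩

variable (S)

/-- The generators of `C*(S)` satisfy the relations (L1)-(L4). -/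
def universalFamily : LiFamily S (FullCStar S) where
  v := isom
  e := proj
  isometry p := Subtype.ext (lp.ext (funext fun ρ => ρ.family.isometry p))
  projection X :=
    ⟨Subtype.ext (lp.ext (funext fun ρ => (ρ.family.projection X).isIdempotentElem)),
      Subtype.ext (lp.ext (funext fun ρ => (ρ.family.projection X).isSelfAdjoint))⟩
  v_mul p q := Subtype.ext (lp.ext (funext fun ρ => ρ.family.v_mul p q))
  conj p X := Subtype.ext (lp.ext (funext fun ρ => ρ.family.conj p X))
  e_empty := Subtype.ext (lp.ext (funext fun ρ => ρ.family.e_empty))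
  e_univ := Subtype.ext (lp.ext (funext fun ρ => ρ.family.e_univ))
  e_mul X Y := Subtype.ext (lp.ext (funext fun ρ => ρ.family.e_mul X Y))

/-- The diagonal `𝒟 = C*({e_X | X ∈ 𝒥(S)})`. -/
def diagonal : StarSubalgebra ℂ (FullCStar S) :=
  (StarAlgebra.adjoin ℂ (Set.range (proj (S := S)))).topologicalClosure

/-- The inner core `𝒞_I = C*({e_{pS}, v_x | p ∈ S, x ∈ S*})`. -/
def innerCore : StarSubalgebra ℂ (FullCStar S) :=
  (StarAlgebra.adjoin ℂ
    (Set.range (fun p : S => proj (.principal p)) ∪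
      Set.range (fun x : Sˣ => isom (x : S)))).topologicalClosure

instance : IsClosed (diagonal S : Set (FullCStar S)) :=
  StarSubalgebra.isClosed_topologicalClosure _

instance : IsClosed (innerCore S : Set (FullCStar S)) :=
  StarSubalgebra.isClosed_topologicalClosure _

variable {S}

theorem proj_mem_diagonal (X : ConstructibleIdeal S) : proj X ∈ diagonal S :=
  StarSubalgebra.le_topologicalClosure _ (StarAlgebra.subset_adjoin ℂ _ ⟨X, rfl⟩)

theorem proj_mem_innerCore (p : S) : proj (.principal p) ∈ innerCore S :=
  StarSubalgebra.le_topologicalClosure _ (StarAlgebra.subset_adjoin ℂ _ (Or.inl ⟨p, rfl⟩))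

theorem isom_mem_innerCore (x : Sˣ) : isom (x : S) ∈ innerCore S :=
  StarSubalgebra.le_topologicalClosure _ (StarAlgebra.subset_adjoin ℂ _ (Or.inr ⟨x, rfl⟩))

/-- In a right LCM semigroup every constructible right ideal is empty or principal. -/
theorem IsConstructible.eq_empty_or_principal (hLCM : IsRightLCM S) {X : Set S}
    (hX : IsConstructible X) : X = ∅ ∨ ∃ p : S, X = principalIdeal p := by
  induction hX with
  | empty => exact Or.inl rfl
  | univ => exact Or.inr ⟨1, by simp [principalIdeal]⟩
  | image p _ ih =>
    rcases ih with rfl | ⟨q, rfl⟩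
    · exact Or.inl (Set.image_empty _)
    · refine Or.inr ⟨p * q, ?_⟩
      rw [principalIdeal, principalIdeal, ← Set.range_comp]
      congr 1
      funext s
      simp [mul_assoc]
  | preimage p _ ih =>
    rcases ih with rfl | ⟨q, rfl⟩
    · exact Or.inl rfl
    · rcases Set.eq_empty_or_nonempty (principalIdeal p ∩ principalIdeal q) with h | h
      · left
        ext y
        simp only [Set.mem_preimage, Set.mem_empty_iff_false, iff_false]
        intro hy
        have : p * y ∈ principalIdeal p ∩ principalIdeal q := ⟨⟨y, rfl⟩, hy⟩
        rw [h] at this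
        exact this
      · right
        obtain ⟨r, hr⟩ := hLCM p q h
        have hrr : r ∈ principalIdeal p ∩ principalIdeal q := by
          rw [hr]
          exact ⟨1, mul_one r⟩
        obtain ⟨⟨s, rfl⟩, -⟩ := hrr
        refine ⟨s, ?_⟩
        ext y
        constructor
        · intro hy
          have : p * y ∈ principalIdeal p ∩ principalIdeal q := ⟨⟨y, rfl⟩, hy⟩
          rw [hr] at this
          obtain ⟨t, ht⟩ := this
          refine ⟨t, mul_left_cancel (a := p) ?_⟩
          simpa [mul_assoc] using ht
        · rintro ⟨t, rfl⟩
          have : p * s * t ∈ principalIdeal p ∩ principalIdeal q := by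
            rw [hr]
            exact ⟨t, rfl⟩
          simpa [mul_assoc] using this.2

theorem proj_eq_zero_or_principal (hLCM : IsRightLCM S) (X : ConstructibleIdeal S) :
    proj X = 0 ∨ ∃ p : S, X = .principal p := by
  rcases X.2.eq_empty_or_principal hLCM with h | ⟨p, hp⟩
  · left
    have hX : X = .empty := Subtype.ext h
    rw [hX]
    exact (universalFamily S).e_empty
  · exact Or.inr ⟨p, Subtype.ext hp⟩

theorem diagonal_le_innerCore (hLCM : IsRightLCM S) : diagonal S ≤ innerCore S := by
  refine StarSubalgebra.topologicalClosure_minimal (StarAlgebra.adjoin_le ?_) inferInstance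
  rintro _ ⟨X, rfl⟩
  rcases proj_eq_zero_or_principal hLCM X with h | ⟨p, rfl⟩
  · rw [h]
    exact zero_mem _
  · exact proj_mem_innerCore p

theorem isom_one : isom (1 : S) = 1 := by
  have h1 := (universalFamily S).isometry 1
  have h2 := (universalFamily S).v_mul 1 1
  change star (isom (1 : S)) * isom 1 = 1 at h1
  change isom (1 : S) * isom 1 = isom (1 * 1) at h2
  rw [mul_one] at h2
  calc isom (1 : S) = star (isom (1 : S)) * isom 1 * isom 1 := by rw [h1, one_mul]
    _ = 1 := by rw [mul_assoc, h2, h1]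

theorem isom_mul (p q : S) : isom p * isom q = isom (p * q) := (universalFamily S).v_mul p q

theorem star_isom_mul_isom (p : S) : star (isom p) * isom p = 1 := (universalFamily S).isometry p

theorem isom_mul_star (p : S) : isom p * star (isom p) = proj (.principal p) := by
  have h := (universalFamily S).conj p .univ
  rw [(universalFamily S).e_univ, mul_one] at h
  have hX : ConstructibleIdeal.translate p .univ = .principal p :=
    Subtype.ext Set.image_univ
  rw [hX] at h
  exact h

/-! ### Spanning monomials -/

theorem star_isom_mul_isom_cases (hLCM : IsRightLCM S) (q p : S) :
    star (isom q) * isom p = 0 ∨ ∃ a b : S, star (isom q) * isom p = isom a * star (isom b) := by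
  have h0 : star (isom q) * isom p =
      star (isom q) * (proj (.principal q) * proj (.principal p)) * isom p := by
    rw [← isom_mul_star, ← isom_mul_star]
    calc star (isom q) * isom p
        = (star (isom q) * isom q) * star (isom q) * (isom p * (star (isom p) * isom p)) := by
          rw [star_isom_mul_isom, star_isom_mul_isom, one_mul, mul_one]
      _ = _ := by simp only [mul_assoc]
  have h1 : proj (.principal q) * proj (.principal p) =
      proj (ConstructibleIdeal.inter (.principal q) (.principal p)) :=
    (universalFamily S).e_mul _ _
  rw [h1] at h0
  rcases Set.eq_empty_or_nonempty (principalIdeal q ∩ principalIdeal p) with h | h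
  · left
    have hX : ConstructibleIdeal.inter (.principal q) (.principal p) =
      (ConstructibleIdeal.empty : ConstructibleIdeal S) := Subtype.ext h
    have h2 : proj (ConstructibleIdeal.empty : ConstructibleIdeal S) = 0 :=
      (universalFamily S).e_empty
    rw [h0, hX, h2, mul_zero, zero_mul]
  · right
    obtain ⟨r, hr⟩ := hLCM q p h
    have hX : ConstructibleIdeal.inter (.principal q) (.principal p) = .principal r :=
      Subtype.ext hr
    have hrr : r ∈ principalIdeal q ∩ principalIdeal p := by
      rw [hr]
      exact ⟨1, mul_one r⟩
    obtain ⟨⟨a, ha⟩, ⟨b, hb⟩⟩ := hrr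
    refine ⟨a, b, ?_⟩
    have hra : isom r = isom q * isom a := by rw [isom_mul]; exact congrArg isom ha.symm
    have hrb : isom r = isom p * isom b := by rw [isom_mul]; exact congrArg isom hb.symm
    rw [h0, hX, ← isom_mul_star]
    have hrr : isom r * star (isom r) = isom q * isom a * (star (isom b) * star (isom p)) :=
      congrArg₂ (· * ·) hra (by rw [hrb, star_mul])
    calc star (isom q) * (isom r * star (isom r)) * isom p
        = (star (isom q) * isom q) * isom a * (star (isom b) * (star (isom p) * isom p)) := by
          rw [hrr]
          simp only [mul_assoc]
      _ = isom a * star (isom b) := by simp [star_isom_mul_isom]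

/-- The linear span of the monomials `v_p v_q*`. -/
def monomialSpan (S : Type u) [Monoid S] [IsLeftCancelMul S] : Submodule ℂ (FullCStar S) :=
  Submodule.span ℂ (Set.range fun pq : S × S => isom pq.1 * star (isom pq.2))

theorem monomial_mem (p q : S) : isom p * star (isom q) ∈ monomialSpan S :=
  Submodule.subset_span ⟨(p, q), rfl⟩

theorem isom_mem_monomialSpan (p : S) : isom p ∈ monomialSpan S := by
  have h := monomial_mem p 1
  rwa [isom_one, star_one, mul_one] at h

theorem monomialSpan_mul (hLCM : IsRightLCM S) {a b : FullCStar S} (ha : a ∈ monomialSpan S)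
    (hb : b ∈ monomialSpan S) : a * b ∈ monomialSpan S := by
  have hab := Submodule.mul_mem_mul ha hb
  rw [monomialSpan, Submodule.span_mul_span] at hab
  refine Submodule.span_le.2 ?_ hab
  rintro _ ⟨_, ⟨⟨p, q⟩, rfl⟩, _, ⟨⟨r, s⟩, rfl⟩, rfl⟩
  change isom p * star (isom q) * (isom r * star (isom s)) ∈ monomialSpan S
  have h : isom p * star (isom q) * (isom r * star (isom s)) =
      isom p * (star (isom q) * isom r) * star (isom s) := by simp only [mul_assoc]
  rw [h]
  rcases star_isom_mul_isom_cases hLCM q r with h0 | ⟨x, y, hxy⟩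
  · rw [h0, mul_zero, zero_mul]
    exact zero_mem _
  · have h2 : isom p * (isom x * star (isom y)) * star (isom s) =
        isom (p * x) * star (isom (s * y)) := by
      rw [← isom_mul, ← isom_mul, star_mul]
      simp only [mul_assoc]
    rw [hxy, h2]
    exact monomial_mem _ _

theorem monomialSpan_star {a : FullCStar S} (ha : a ∈ monomialSpan S) :
    star a ∈ monomialSpan S := by
  induction ha using Submodule.span_induction with
  | mem x hx =>
    obtain ⟨⟨p, q⟩, rfl⟩ := hx
    simpa using monomial_mem q p
  | zero => simp
  | add x y _ _ hx hy => simpa using add_mem hx hy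
  | smul c x _ hx => simpa using Submodule.smul_mem _ (star c) hx

/-- The span of the monomials as a unital `*`-subalgebra. -/
def monomialAlgebra (hLCM : IsRightLCM S) : StarSubalgebra ℂ (FullCStar S) where
  carrier := monomialSpan S
  mul_mem' := monomialSpan_mul hLCM
  add_mem' := add_mem
  algebraMap_mem' c := by
    rw [Algebra.algebraMap_eq_smul_one, ← isom_one]
    exact Submodule.smul_mem _ c (isom_mem_monomialSpan 1)
  star_mem' := monomialSpan_star

/-- `C*(S)` is the closed linear span of the monomials `v_p v_q*`. -/
theorem mem_closure_monomialSpan (hLCM : IsRightLCM S) (a : FullCStar S) :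
    a ∈ closure (monomialSpan S : Set (FullCStar S)) := by
  rw [(isometry_toProduct S).isUniformInducing.isInducing.closure_eq_preimage_closure_image]
  have h : StarAlgebra.adjoin ℂ
      (Set.range (prodV (S := S)) ∪ Set.range (prodE (S := S))) ≤
      (monomialAlgebra hLCM).map (toProduct S) := by
    refine StarAlgebra.adjoin_le ?_
    rintro _ (⟨p, rfl⟩ | ⟨X, rfl⟩)
    · exact ⟨isom p, isom_mem_monomialSpan p, rfl⟩
    · refine ⟨proj X, ?_, rfl⟩
      rcases proj_eq_zero_or_principal hLCM X with h | ⟨p, rfl⟩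
      · rw [h]
        exact zero_mem (monomialSpan S)
      · rw [← isom_mul_star]
        exact monomial_mem p p
  have ha : toProduct S a ∈ closure
      (StarAlgebra.adjoin ℂ (Set.range (prodV (S := S)) ∪ Set.range (prodE (S := S))) :
        Set (RepProduct S)) := a.2
  exact closure_mono h ha

end FullAlgebra

/-! ## The conditional expectation onto the inner core -/

/-- `Φ : A → B` is a conditional expectation onto the C*-subalgebra `j(B)` of `A`: a contractive
positive projection which is `B`-bilinear. -/
structure IsConditionalExpectation {A B : Type w} [CStarAlgebra A] [CStarAlgebra B]
    (j : B →⋆ₐ[ℂ] A) (Φ : A →ₗ[ℂ] B) : Prop where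
  map_coe : ∀ b, Φ (j b) = b
  norm_le : ∀ a, ‖Φ a‖ ≤ ‖a‖
  positive : ∀ a, ∃ b, Φ (star a * a) = star b * b
  bilinear : ∀ b a c, Φ (j b * a * j c) = b * Φ a * c

/-- `Φ` is faithful (on positive elements). -/
def IsFaithful {A B : Type w} [CStarAlgebra A] [CStarAlgebra B] (Φ : A →ₗ[ℂ] B) : Prop :=
  ∀ a, Φ (star a * a) = 0 → a = 0

section Twist

variable {Δ : Type u} [Group Δ] {H : Type u} [NormedAddCommGroup H] [InnerProductSpace ℂ H]

/-- The operator `T ⊗ λ_g` on `H ⊗ ℓ²(Δ) = ℓ²(Δ, H)`, where `λ` is the left regular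
representation of `Δ`. -/
def amplify (g : Δ) (T : H →L[ℂ] H) : lp (fun _ : Δ => H) 2 →L[ℂ] lp (fun _ : Δ => H) 2 :=
  have hs (f : lp (fun _ : Δ => H) 2) :
      HasSum (fun γ => ‖f (g⁻¹ * γ)‖ ^ (2 : ℝ≥0∞).toReal) (‖f‖ ^ (2 : ℝ≥0∞).toReal) :=
    (Equiv.mulLeft g⁻¹).hasSum_iff.2 (lp.hasSum_norm (by simp) f)
  have hle (f : lp (fun _ : Δ => H) 2) (γ : Δ) : ‖T (f (g⁻¹ * γ))‖ ^ (2 : ℝ≥0∞).toReal ≤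
      ‖T‖ ^ (2 : ℝ≥0∞).toReal * ‖f (g⁻¹ * γ)‖ ^ (2 : ℝ≥0∞).toReal := by
    rw [← Real.mul_rpow (norm_nonneg _) (norm_nonneg _)]
    exact Real.rpow_le_rpow (norm_nonneg _) (T.le_opNorm _) (by simp)
  have hm (f : lp (fun _ : Δ => H) 2) :
      Summable fun γ => ‖T (f (g⁻¹ * γ))‖ ^ (2 : ℝ≥0∞).toReal :=
    Summable.of_nonneg_of_le (fun γ => Real.rpow_nonneg (norm_nonneg _) _) (hle f)
      ((hs f).summable.mul_left _)
  LinearMap.mkContinuous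
    { toFun := fun f => ⟨fun γ => T (f (g⁻¹ * γ)), memℓp_gen (hm f)⟩
      map_add' := fun f f' => lp.ext (funext fun γ => map_add T _ _)
      map_smul' := fun c f => lp.ext (funext fun γ => map_smul T c _) }
    ‖T‖
    (fun f => by
      refine lp.norm_le_of_tsum_le (by simp) (by positivity) ?_
      rw [Real.mul_rpow (norm_nonneg _) (norm_nonneg _), ← (hs f).tsum_eq, ← tsum_mul_left]
      exact (hm f).tsum_le_tsum (hle f) ((hs f).summable.mul_left _))

theorem norm_amplify_le (g : Δ) (T : H →L[ℂ] H) : ‖amplify g T‖ ≤ ‖T‖ := by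
  unfold amplify
  exact LinearMap.mkContinuous_norm_le _ (norm_nonneg _) _

theorem amplify_apply (g : Δ) (T : H →L[ℂ] H) (f : lp (fun _ : Δ => H) 2) (γ : Δ) :
    amplify g T f γ = T (f (g⁻¹ * γ)) := rfl

theorem amplify_mul (g h : Δ) (T U : H →L[ℂ] H) :
    amplify g T * amplify h U = amplify (g * h) (T * U) := by
  ext f γ
  change T (U (f (h⁻¹ * (g⁻¹ * γ)))) = T (U (f ((g * h)⁻¹ * γ)))
  rw [mul_inv_rev, mul_assoc]

theorem amplify_one : amplify (1 : Δ) (1 : H →L[ℂ] H) = 1 := by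
  ext f γ
  change f (1⁻¹ * γ) = f γ
  simp

theorem amplify_zero (g : Δ) : amplify g (0 : H →L[ℂ] H) = 0 := by
  ext f γ
  rfl

variable (Δ H) in
open Classical in
/-- The embedding of `H` into `ℓ²(Δ, H)` as the functions supported at `1`. -/
def atOne : H →L[ℂ] lp (fun _ : Δ => H) 2 :=
  LinearMap.mkContinuous (lp.lsingle (𝕜 := ℂ) (E := fun _ : Δ => H) 2 (1 : Δ)) 1
    (fun x => by
      rw [one_mul]
      exact (lp.norm_single (E := fun _ : Δ => H) (by simp) (1 : Δ) x).le)

open Classical in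
theorem atOne_apply (x : H) : atOne Δ H x = lp.single (E := fun _ : Δ => H) 2 (1 : Δ) x := rfl

theorem norm_atOne_le : ‖atOne Δ H‖ ≤ 1 := LinearMap.mkContinuous_norm_le _ zero_le_one _

variable [CompleteSpace H]

theorem star_amplify (g : Δ) (T : H →L[ℂ] H) : star (amplify g T) = amplify g⁻¹ (star T) := by
  symm
  refine (ContinuousLinearMap.eq_adjoint_iff _ _).2 fun f f' => ?_
  rw [lp.inner_eq_tsum, lp.inner_eq_tsum, ← (Equiv.mulLeft g⁻¹).tsum_eq]
  refine tsum_congr fun γ => ?_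
  simp only [amplify_apply, Equiv.coe_mulLeft, inv_inv, mul_inv_cancel_left,
    ContinuousLinearMap.star_eq_adjoint, ContinuousLinearMap.adjoint_inner_left]

theorem adjoint_atOne_apply (f : lp (fun _ : Δ => H) 2) :
    ContinuousLinearMap.adjoint (atOne Δ H) f = f 1 := by
  classical
  refine ext_inner_right ℂ fun x => ?_
  rw [ContinuousLinearMap.adjoint_inner_left, atOne_apply, lp.inner_single_right]

open Classical in
theorem compress_amplify (g : Δ) (T : H →L[ℂ] H) :
    (ContinuousLinearMap.adjoint (atOne Δ H)).comp ((amplify g T).comp (atOne Δ H)) =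
      if g = 1 then T else 0 := by
  ext x
  rw [ContinuousLinearMap.comp_apply, adjoint_atOne_apply, ContinuousLinearMap.comp_apply,
    amplify_apply, atOne_apply]
  split_ifs with h
  · subst h
    simp
  · have hg : g⁻¹ * 1 ≠ 1 := by simpa using h
    rw [lp.single_apply_ne _ _ _ hg, map_zero]
    rfl

instance [Nontrivial H] : Nontrivial (lp (fun _ : Δ => H) 2) := by
  classical
  obtain ⟨x, hx⟩ := exists_ne (0 : H)
  refine ⟨⟨lp.single 2 (1 : Δ) x, 0, fun h => hx ?_⟩⟩
  have := congrArg (fun f : lp (fun _ : Δ => H) 2 => f 1) h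
  simpa using this

variable {S : Type u} [Monoid S] [IsLeftCancelMul S]

/-- The representation `v_p ↦ ρ(v_p) ⊗ λ_{σ(p)}`, `e_X ↦ ρ(e_X) ⊗ 1` on `H_ρ ⊗ ℓ²(Δ)`. -/
def twist (σ : S →* Δ) (ρ : LiRepresentation S) : LiRepresentation S where
  H := lp (fun _ : Δ => ρ.H) 2
  family :=
    { v := fun p => amplify (σ p) (ρ.family.v p)
      e := fun X => amplify 1 (ρ.family.e X)
      isometry := fun p => by
        rw [star_amplify, amplify_mul, ρ.family.isometry, inv_mul_cancel, amplify_one]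
      projection := fun X =>
        ⟨by
          rw [IsIdempotentElem, amplify_mul, (ρ.family.projection X).isIdempotentElem.eq, one_mul],
        by
          rw [IsSelfAdjoint, star_amplify, (ρ.family.projection X).isSelfAdjoint.star_eq, inv_one]⟩
      v_mul := fun p q => by rw [amplify_mul, ρ.family.v_mul, map_mul]
      conj := fun p X => by
        rw [star_amplify, amplify_mul, amplify_mul, ρ.family.conj, mul_one, mul_inv_cancel]
      e_empty := by rw [ρ.family.e_empty, amplify_zero]
      e_univ := by rw [ρ.family.e_univ, amplify_one]
      e_mul := fun X Y => by rw [amplify_mul, ρ.family.e_mul, mul_one] }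

theorem norm_compress_apply_le (σ : S →* Δ) (a : RepProduct S) (ρ : LiRepresentation S) :
    ‖(ContinuousLinearMap.adjoint (atOne Δ ρ.H)).comp ((a (twist σ ρ)).comp (atOne Δ ρ.H))‖ ≤
      ‖a‖ := by
  have h1 : ‖atOne Δ ρ.H‖ ≤ 1 := norm_atOne_le
  have h2 : ‖ContinuousLinearMap.adjoint (atOne Δ ρ.H)‖ ≤ 1 := by
    rwa [LinearIsometryEquiv.norm_map]
  have h3 : ‖a (twist σ ρ)‖ ≤ ‖a‖ := lp.norm_apply_le_norm (by simp) a _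
  calc _ ≤ ‖ContinuousLinearMap.adjoint (atOne Δ ρ.H)‖ *
        (‖a (twist σ ρ)‖ * ‖atOne Δ ρ.H‖) :=
        (ContinuousLinearMap.opNorm_comp_le _ _).trans
          (mul_le_mul_of_nonneg_left (ContinuousLinearMap.opNorm_comp_le _ _) (norm_nonneg _))
    _ ≤ 1 * (‖a‖ * 1) := by gcongr
    _ = ‖a‖ := by ring

/-- The map which sends `a` in the product to the family, indexed by `ρ`, of the compressions to
`H_ρ ⊆ ℓ²(Δ, H_ρ)` of the coordinates of `a` at the twisted representations. -/
def compress (σ : S →* Δ) : RepProduct S →ₗ[ℂ] RepProduct S where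
  toFun a :=
    ⟨fun ρ =>
      (ContinuousLinearMap.adjoint (atOne Δ ρ.H)).comp ((a (twist σ ρ)).comp (atOne Δ ρ.H)),
      memℓp_infty ⟨‖a‖, by
        rintro _ ⟨ρ, rfl⟩
        exact norm_compress_apply_le σ a ρ⟩⟩
  map_add' a b := by
    refine lp.ext (funext fun ρ => ?_)
    ext x
    exact map_add (ContinuousLinearMap.adjoint (atOne Δ ρ.H)) _ _
  map_smul' c a := by
    refine lp.ext (funext fun ρ => ?_)
    ext x
    exact map_smul (ContinuousLinearMap.adjoint (atOne Δ ρ.H)) c _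

theorem compress_apply (σ : S →* Δ) (a : RepProduct S) (ρ : LiRepresentation S) :
    compress σ a ρ =
      (ContinuousLinearMap.adjoint (atOne Δ ρ.H)).comp ((a (twist σ ρ)).comp (atOne Δ ρ.H)) := rfl

theorem norm_compress_le (σ : S →* Δ) (a : RepProduct S) : ‖compress σ a‖ ≤ ‖a‖ :=
  lp.norm_le_of_forall_le (norm_nonneg _) fun ρ => norm_compress_apply_le σ a ρ

open Classical in
theorem compress_monomial (σ : S →* Δ) (p q : S) :
    compress σ (toProduct S (isom p * star (isom q))) =
      if σ p = σ q then toProduct S (isom p * star (isom q)) else 0 := by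
  refine lp.ext (funext fun ρ => ?_)
  have h1 := compress_amplify (σ p * (σ q)⁻¹) (ρ.family.v p * star (ρ.family.v q))
  rw [← amplify_mul, ← star_amplify] at h1
  refine Eq.trans h1 ?_
  by_cases h : σ p = σ q
  · rw [if_pos h, if_pos (mul_inv_eq_one.2 h)]
    rfl
  · rw [if_neg h, if_neg (fun h' => h (mul_inv_eq_one.1 h'))]
    rfl

theorem monomial_of_unit (x : Sˣ) (q : S) :
    isom ((x : S) * q) * star (isom q) = isom (x : S) * proj (.principal q) := by
  rw [← isom_mul, mul_assoc, isom_mul_star]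

theorem monomial_mem_innerCore (x : Sˣ) (q : S) :
    isom ((x : S) * q) * star (isom q) ∈ innerCore S := by
  rw [monomial_of_unit]
  exact mul_mem (isom_mem_innerCore x) (proj_mem_innerCore q)

theorem exists_compress_eq (hLCM : IsRightLCM S) (σ : S →* Δ)
    (hσ : ∀ p q, σ p = σ q → ∃ x : Sˣ, p = x * q) (a : FullCStar S) :
    ∃ c : innerCore S, toProduct S c = compress σ (toProduct S a) := by
  have hcont : Continuous fun b : FullCStar S => compress σ (toProduct S b) :=
    ((compress σ).mkContinuous 1 (fun b => by
      rw [one_mul]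
      exact norm_compress_le σ b)).continuous.comp (isometry_toProduct S).continuous
  have hclosed : IsClosed (toProduct S '' (innerCore S : Set (FullCStar S))) :=
    (isometry_toProduct S).isClosedEmbedding.isClosedMap _ inferInstance
  have hsub : (monomialSpan S : Set (FullCStar S)) ⊆
      (fun b : FullCStar S => compress σ (toProduct S b)) ⁻¹'
        (toProduct S '' (innerCore S : Set (FullCStar S))) := by
    intro b hb
    induction hb using Submodule.span_induction with
    | mem b hb =>
      obtain ⟨⟨p, q⟩, rfl⟩ := hb
      by_cases h : σ p = σ q
      · obtain ⟨x, hx⟩ := hσ p q h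
        refine ⟨isom p * star (isom q), ?_, ?_⟩
        · rw [hx]
          exact monomial_mem_innerCore x q
        · exact ((compress_monomial σ p q).trans (if_pos h)).symm
      · refine ⟨0, zero_mem _, ?_⟩
        rw [map_zero]
        exact ((compress_monomial σ p q).trans (if_neg h)).symm
    | zero => exact ⟨0, zero_mem _, by simp⟩
    | add b b' _ _ hb hb' =>
      obtain ⟨c, hc, hcb⟩ := hb
      obtain ⟨c', hc', hcb'⟩ := hb'
      exact ⟨c + c', add_mem hc hc', by
        simp only [map_add] at hcb hcb' ⊢
        rw [hcb, hcb']⟩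
    | smul z b _ hb =>
      obtain ⟨c, hc, hcb⟩ := hb
      exact ⟨z • c, SMulMemClass.smul_mem z hc, by
        simp only [map_smul] at hcb ⊢
        rw [hcb]⟩
  obtain ⟨c, hc, hca⟩ := closure_minimal hsub (hclosed.preimage hcont)
    (mem_closure_monomialSpan hLCM a)
  exact ⟨⟨c, hc⟩, hca⟩

theorem toProduct_innerCore_injective :
    Function.Injective fun c : innerCore S => toProduct S c :=
  (isometry_toProduct S).injective.comp Subtype.val_injective

/-- The expectation `v_p v_q* ↦ [σ(p) = σ(q)] v_p v_q*`. -/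
def gradedExpectation (hLCM : IsRightLCM S) (σ : S →* Δ)
    (hσ : ∀ p q, σ p = σ q → ∃ x : Sˣ, p = x * q) : FullCStar S →ₗ[ℂ] innerCore S where
  toFun a := (exists_compress_eq hLCM σ hσ a).choose
  map_add' a b := toProduct_innerCore_injective <| by
    have h := (exists_compress_eq hLCM σ hσ (a + b)).choose_spec
    have ha := (exists_compress_eq hLCM σ hσ a).choose_spec
    have hb := (exists_compress_eq hLCM σ hσ b).choose_spec
    exact h.trans <| (congrArg (compress σ) (map_add (toProduct S) a b)).trans <|
      (map_add (compress σ) _ _).trans ((congrArg₂ (· + ·) ha hb).symm.trans (map_add (toProduct S) _ _).symm)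
  map_smul' z a := toProduct_innerCore_injective <| by
    have h := (exists_compress_eq hLCM σ hσ (z • a)).choose_spec
    have ha := (exists_compress_eq hLCM σ hσ a).choose_spec
    exact h.trans <| (congrArg (compress σ) (map_smul (toProduct S) z a)).trans <|
      (map_smul (compress σ) z _).trans ((congrArg (z • ·) ha).symm.trans (map_smul (toProduct S) z _).symm)

theorem toProduct_gradedExpectation (hLCM : IsRightLCM S) (σ : S →* Δ)
    (hσ : ∀ p q, σ p = σ q → ∃ x : Sˣ, p = x * q) (a : FullCStar S) :
    toProduct S (gradedExpectation hLCM σ hσ a) = compress σ (toProduct S a) :=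
  (exists_compress_eq hLCM σ hσ a).choose_spec

/-- Projection of the product to its `ρ`-th coordinate. -/
def evalHom (ρ : LiRepresentation S) : RepProduct S →⋆ₐ[ℂ] (ρ.H →L[ℂ] ρ.H) where
  toFun a := a ρ
  map_one' := rfl
  map_mul' _ _ := rfl
  map_zero' := rfl
  map_add' _ _ := rfl
  commutes' _ := rfl
  map_star' _ := rfl

variable (Δ H) in
/-- `T ↦ T ⊗ 1` as a `*`-homomorphism. -/
def amplifyHom : (H →L[ℂ] H) →⋆ₐ[ℂ] (lp (fun _ : Δ => H) 2 →L[ℂ] lp (fun _ : Δ => H) 2) where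
  toFun T := amplify 1 T
  map_one' := amplify_one
  map_mul' T U := by rw [amplify_mul, mul_one]
  map_zero' := amplify_zero 1
  map_add' _ _ := rfl
  commutes' c := by
    rw [Algebra.algebraMap_eq_smul_one, Algebra.algebraMap_eq_smul_one, ← amplify_one]
    rfl
  map_star' T := by rw [star_amplify, inv_one]

/-- The extension of a representation `ρ` of the relations (L1)-(L4) to `C*(S)`. -/
def extend (ρ : LiRepresentation S) : FullCStar S →⋆ₐ[ℂ] (ρ.H →L[ℂ] ρ.H) :=
  (evalHom ρ).comp (toProduct S)

theorem extend_isom (ρ : LiRepresentation S) (p : S) : extend ρ (isom p) = ρ.family.v p := rfl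

theorem extend_proj (ρ : LiRepresentation S) (X : ConstructibleIdeal S) :
    extend ρ (proj X) = ρ.family.e X := rfl

theorem continuous_evalHom (ρ : LiRepresentation S) : Continuous (evalHom ρ) :=
  AddMonoidHomClass.continuous_of_bound (evalHom ρ) 1 fun a => by
    rw [one_mul]
    exact lp.norm_apply_le_norm (by simp) a ρ

theorem continuous_amplifyHom : Continuous (amplifyHom Δ H) :=
  AddMonoidHomClass.continuous_of_bound (amplifyHom Δ H) 1 fun T => by
    rw [one_mul]
    exact norm_amplify_le 1 T

theorem coe_twist_of_mem_innerCore (σ : S →* Δ) (hσ : ∀ x : Sˣ, σ x = 1) (ρ : LiRepresentation S)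
    {c : FullCStar S} (hc : c ∈ innerCore S) :
    toProduct S c (twist σ ρ) = amplify 1 (toProduct S c ρ) := by
  let f : FullCStar S →⋆ₐ[ℂ] ((twist σ ρ).H →L[ℂ] (twist σ ρ).H) :=
    (evalHom (twist σ ρ)).comp (toProduct S)
  let g : FullCStar S →⋆ₐ[ℂ] ((twist σ ρ).H →L[ℂ] (twist σ ρ).H) :=
    (amplifyHom Δ ρ.H).comp ((evalHom ρ).comp (toProduct S))
  have hf : Continuous f :=
    (continuous_evalHom (twist σ ρ)).comp (isometry_toProduct S).continuous
  have hg : Continuous g := continuous_amplifyHom.comp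
    ((continuous_evalHom ρ).comp (isometry_toProduct S).continuous)
  have hle : innerCore S ≤ StarAlgHom.equalizer f g := by
    refine StarSubalgebra.topologicalClosure_minimal (StarAlgebra.adjoin_le ?_)
      (isClosed_eq hf hg)
    rintro _ (⟨p, rfl⟩ | ⟨x, rfl⟩)
    · exact rfl
    · change amplify (σ x) (ρ.family.v x) = amplify 1 (ρ.family.v x)
      rw [hσ]
  exact hle hc

theorem atOne_comp (T : H →L[ℂ] H) :
    (amplify 1 T).comp (atOne Δ H) = (atOne Δ H).comp T := by
  classical
  ext x γ
  change T (atOne Δ H x (1⁻¹ * γ)) = atOne Δ H (T x) γ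
  rw [inv_one, one_mul, atOne_apply, atOne_apply]
  by_cases h : γ = 1
  · subst h
    rw [lp.single_apply_self, lp.single_apply_self]
  · rw [lp.single_apply_ne _ _ _ h, lp.single_apply_ne _ _ _ h, map_zero]

theorem adjoint_atOne_comp (T : H →L[ℂ] H) :
    (ContinuousLinearMap.adjoint (atOne Δ H)).comp (amplify 1 T) =
      T.comp (ContinuousLinearMap.adjoint (atOne Δ H)) := by
  ext f
  rw [ContinuousLinearMap.comp_apply, ContinuousLinearMap.comp_apply, adjoint_atOne_apply,
    adjoint_atOne_apply, amplify_apply, inv_one, one_mul]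

theorem compress_bilinear (σ : S →* Δ) (hσ : ∀ x : Sˣ, σ x = 1) {b c : FullCStar S}
    (hb : b ∈ innerCore S) (hc : c ∈ innerCore S) (a : FullCStar S) :
    compress σ (toProduct S (b * a * c)) =
      toProduct S b * compress σ (toProduct S a) * toProduct S c := by
  refine lp.ext (funext fun ρ => ?_)
  have h (T U : ρ.H →L[ℂ] ρ.H) (V : lp (fun _ : Δ => ρ.H) 2 →L[ℂ] lp (fun _ : Δ => ρ.H) 2) :
      (ContinuousLinearMap.adjoint (atOne Δ ρ.H)).comp
        ((amplify 1 T * V * amplify 1 U).comp (atOne Δ ρ.H)) =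
      T * (ContinuousLinearMap.adjoint (atOne Δ ρ.H)).comp (V.comp (atOne Δ ρ.H)) * U := by
    calc _ = ((ContinuousLinearMap.adjoint (atOne Δ ρ.H)).comp (amplify 1 T)).comp
          (V.comp ((amplify 1 U).comp (atOne Δ ρ.H))) := rfl
      _ = _ := by
        rw [atOne_comp, adjoint_atOne_comp]
        rfl
  have h1 := h (toProduct S b ρ) (toProduct S c ρ) (toProduct S a (twist σ ρ))
  rw [← coe_twist_of_mem_innerCore σ hσ ρ hb, ← coe_twist_of_mem_innerCore σ hσ ρ hc] at h1
  exact h1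

theorem compress_of_mem (σ : S →* Δ) (hσ : ∀ x : Sˣ, σ x = 1) {c : FullCStar S}
    (hc : c ∈ innerCore S) : compress σ (toProduct S c) = toProduct S c := by
  refine lp.ext (funext fun ρ => ?_)
  have h := compress_amplify (1 : Δ) (toProduct S c ρ)
  rw [if_pos rfl, ← coe_twist_of_mem_innerCore σ hσ ρ hc] at h
  exact h

theorem compress_isPositive (σ : S →* Δ) (a : RepProduct S) (ρ : LiRepresentation S) :
    (compress σ (star a * a) ρ).IsPositive := by
  have h (V : (twist σ ρ).H →L[ℂ] (twist σ ρ).H) (W : ρ.H →L[ℂ] (twist σ ρ).H) :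
      ((ContinuousLinearMap.adjoint W).comp ((star V * V).comp W)).IsPositive := by
    have h1 : (ContinuousLinearMap.adjoint W).comp ((star V * V).comp W) =
        (ContinuousLinearMap.adjoint (V.comp W)).comp (V.comp W) := by
      rw [ContinuousLinearMap.adjoint_comp]
      rfl
    rw [h1]
    exact ContinuousLinearMap.isPositive_adjoint_comp_self _
  exact h (a (twist σ ρ)) (atOne Δ ρ.H)

/-- An element of `𝒞_I` which is positive in every representation is of the form `star b * b`. -/
theorem exists_eq_star_mul_self {c : innerCore S}
    (hc : ∀ ρ, (toProduct S (c : FullCStar S) ρ).IsPositive) : ∃ b, c = star b * b := by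
  let _ : PartialOrder (innerCore S) := CStarAlgebra.spectralOrder _
  have _ : StarOrderedRing (innerCore S) := CStarAlgebra.spectralOrderedRing _
  have hsa : IsSelfAdjoint c := by
    refine toProduct_innerCore_injective (lp.ext (funext fun ρ => ?_))
    exact (hc ρ).isSelfAdjoint
  refine CStarAlgebra.nonneg_iff_eq_star_mul_self.1 ?_
  refine (StarOrderedRing.nonneg_iff_spectrum_nonneg (R := ℝ) c hsa).2 ?_
  rw [← SpectrumRestricts.nnreal_iff, SpectrumRestricts.nnreal_iff_nnnorm hsa le_rfl]
  have h1 : ‖algebraMap ℝ (innerCore S) (‖c‖₊ : ℝ) - c‖ =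
      ‖toProduct S ((algebraMap ℝ (innerCore S) (‖c‖₊ : ℝ) - c : innerCore S) : FullCStar S)‖ :=
    rfl
  refine NNReal.coe_le_coe.1 ((coe_nnnorm _).trans_le (h1.trans_le ?_))
  refine lp.norm_le_of_forall_le (norm_nonneg _) fun ρ => ?_
  have h2 : ‖toProduct S (c : FullCStar S) ρ‖₊ ≤ ‖c‖₊ :=
    lp.norm_apply_le_norm (by simp) (toProduct S (c : FullCStar S)) ρ
  have h3 := (SpectrumRestricts.nnreal_iff_nnnorm (hc ρ).isSelfAdjoint h2).1
    (hc ρ).spectrumRestricts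
  exact h3

theorem gradedExpectation_isConditionalExpectation (hLCM : IsRightLCM S) (σ : S →* Δ)
    (hσ : ∀ p q, σ p = σ q → ∃ x : Sˣ, p = x * q) (hσ1 : ∀ x : Sˣ, σ x = 1) :
    IsConditionalExpectation (innerCore S).subtype (gradedExpectation hLCM σ hσ) where
  map_coe c := toProduct_innerCore_injective <|
    (toProduct_gradedExpectation hLCM σ hσ c).trans (compress_of_mem σ hσ1 c.2)
  norm_le a := by
    have h1 : ‖gradedExpectation hLCM σ hσ a‖ =
        ‖toProduct S (gradedExpectation hLCM σ hσ a : FullCStar S)‖ := rfl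
    have h2 : ‖a‖ = ‖toProduct S a‖ := rfl
    rw [h1, h2, toProduct_gradedExpectation]
    exact norm_compress_le σ _
  positive a := by
    refine exists_eq_star_mul_self fun ρ => ?_
    rw [toProduct_gradedExpectation, map_mul, map_star]
    exact compress_isPositive σ _ ρ
  bilinear b a c := toProduct_innerCore_injective <|
    (toProduct_gradedExpectation hLCM σ hσ _).trans <|
      (compress_bilinear σ hσ1 b.2 c.2 a).trans <| by
        rw [← toProduct_gradedExpectation hLCM σ hσ a, ← map_mul, ← map_mul]
        rfl

end Twist


section Expectation

variable {S : Type u} [Monoid S] [IsLeftCancelMul S]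

/-- A group generated by an image of `𝒮 = S/∼` is no larger than `S`. -/
theorem small_of_closure_eq_top {Q : Type u} {Γ : Type w} [Group Γ] (ι : Q → Γ)
    (hgen : Subgroup.closure (Set.range ι) = ⊤) : Small.{u} Γ :=
  small_of_surjective (f := FreeGroup.lift ι)
    (FreeGroup.lift_surjective_iff_closure_range_eq_top.2 hgen)

variable (hLCM : IsRightLCM S) (hC1 : SatisfiesC1 S) {Γ : Type w} [Group Γ]
  (ι : UnitQuotient hC1 →* Γ) (hι : Function.Injective ι)
  (hgen : Subgroup.closure (Set.range ι) = ⊤)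

/-- The conditional expectation `Φ_{𝒞_I} : C*(S) → 𝒞_I` obtained from an embedding of `𝒮` into a
group `Γ` generated by `𝒮`. It sends `v_p v_q*` to `v_x e_{qS}` if `p = x q` for some `x ∈ S*`,
and to `0` if `p ≁ q`. -/
def innerCoreExpectation : FullCStar S →ₗ[ℂ] innerCore S :=
  haveI := small_of_closure_eq_top ι hgen
  gradedExpectation hLCM
    (((Shrink.mulEquiv (α := Γ)).symm.toMonoidHom.comp ι).comp (unitCongruence hC1).mk')
    (fun _ _ h => (unitCongruence hC1).eq.1 (hι ((Shrink.mulEquiv (α := Γ)).symm.injective h)))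

/-- `Φ_{𝒞_I}` is a conditional expectation onto `𝒞_I`. -/
theorem innerCoreExpectation_isConditionalExpectation :
    IsConditionalExpectation (innerCore S).subtype
      (innerCoreExpectation hLCM hC1 ι hι hgen) := by
  have := small_of_closure_eq_top ι hgen
  refine gradedExpectation_isConditionalExpectation hLCM _ _ fun x => ?_
  have hx : (unitCongruence hC1).mk' (x : S) = 1 :=
    (unitCongruence hC1).eq.2 ⟨x, (mul_one _).symm⟩
  rw [MonoidHom.comp_apply, hx, map_one]

/-- `Φ_{𝒞_I}(v_p v_q*) = v_x e_{qS}` if `p = x q` with `x ∈ S*`. -/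
theorem innerCoreExpectation_of_eq (p q : S) (x : Sˣ) (h : p = x * q) :
    (innerCoreExpectation hLCM hC1 ι hι hgen (isom p * star (isom q)) : FullCStar S) =
      isom (x : S) * proj (.principal q) := by
  have h1 := (innerCoreExpectation_isConditionalExpectation hLCM hC1 ι hι hgen).map_coe
    ⟨_, monomial_mem_innerCore x q⟩
  subst h
  exact (congrArg Subtype.val h1).trans (monomial_of_unit x q)

/-- `Φ_{𝒞_I}(v_p v_q*) = 0` if `p ≁ q`. -/
theorem innerCoreExpectation_of_not (p q : S) (h : ¬ ∃ x : Sˣ, p = x * q) :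
    (innerCoreExpectation hLCM hC1 ι hι hgen (isom p * star (isom q)) : FullCStar S) = 0 := by
  have := small_of_closure_eq_top ι hgen
  refine (isometry_toProduct S).injective ?_
  rw [map_zero]
  refine (toProduct_gradedExpectation hLCM _ _ _).trans ((compress_monomial _ p q).trans
    (if_neg fun h' => h ?_))
  exact (unitCongruence hC1).eq.1 (hι ((Shrink.mulEquiv (α := Γ)).symm.injective h'))

/-- The projection `e_{qS}` as an element of `𝒞_I`. -/
def coreProj (q : S) : innerCore S := ⟨proj (.principal q), proj_mem_innerCore q⟩

/-- The unitary `v_x`, `x ∈ S*`, as an element of `𝒞_I`. -/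
def coreIsom (x : Sˣ) : innerCore S := ⟨isom (x : S), isom_mem_innerCore x⟩

/-- The projection `e_X` as an element of `𝒟`. -/
def diagProj (X : ConstructibleIdeal S) : diagonal S := ⟨proj X, proj_mem_diagonal X⟩

end Expectation

end
end RightLCM

open RightLCM

/-! Write `E` for the expectation onto the inner core and `Φ₀` for the one onto the diagonal.
Everything rests on `norm_expectation_le`: if `π` is injective on the inner core, then `‖Φ₀ (E a)‖ ≤
‖π a‖` for every `a`. If `π a = 0`, applying this to `star a * a` gives `Φ₀ (E (star a * a)) = 0`,
and faithfulness of `Φ₀` and then of `E` forces `a = 0`.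

By continuity the estimate is only needed for finite sums `a` of monomials `v_p v_q*`. Then `d = Φ₀
(E a)` is a finite combination of projections `e_{pS}`. By the right LCM property, on finitely many
such projections each character of the diagonal agrees with evaluation at some `r ∈ S`
(`exists_character_eq`). Hence `‖d‖` is bounded by any common bound for the `‖d δ_r‖`, where `δ_r`
runs over the basis vectors of the left regular representation (`norm_le_of_forall_basisVec`).

Fix `r`. A contraction `f` in the diagonal with `f δ_r = δ_r` and `f a f = f E(a) f` is found in
`exists_isCutoff`. For one monomial with `p ≁ q` it is a product of projections `e_X` and `1 - e_X`;
(C1) and cancellation enter here, in `exists_eq_unit_mul`. Since the diagonal is commutative, the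
cutoffs of the different monomials can be multiplied. Finally `‖d δ_r‖ ≤ ‖f d f‖ = ‖Φ₀ (f E(a) f)‖ ≤
‖f E(a) f‖ = ‖π (f E(a) f)‖ = ‖π (f a f)‖ ≤ ‖π a‖`, where the middle equality holds because an
injective `*`-homomorphism is isometric. -/

namespace RightLCM

noncomputable section

/-! ### The left regular representation on `ℓ²(S)` -/

section Regular

variable {S : Type u}

/-- The Hilbert space `ℓ²(S)`. -/
abbrev EllTwo (S : Type u) : Type u := lp (fun _ : S => ℂ) 2

theorem hasSum_norm_extend {g : S → S} (hg : Function.Injective g) (f : EllTwo S) :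
    HasSum (fun t => ‖Function.extend g f (0 : S → ℂ) t‖ ^ (2 : ℝ≥0∞).toReal)
      (‖f‖ ^ (2 : ℝ≥0∞).toReal) := by
  refine (hg.hasSum_iff fun t ht => ?_).1 ?_
  · rw [Function.extend_apply' _ _ _ ht, Pi.zero_apply, norm_zero, Real.zero_rpow (by simp)]
  · simpa [Function.comp_def, hg.extend_apply] using lp.hasSum_norm (by simp) f

/-- The operator on `ℓ²(S)` which maps the basis vector at `s` to the one at `g s`, for an
injective map `g`. -/
def pushforward (g : S → S) (hg : Function.Injective g) : EllTwo S →L[ℂ] EllTwo S :=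
  LinearMap.mkContinuous
    { toFun := fun f => ⟨Function.extend g f (0 : S → ℂ), memℓp_gen (hasSum_norm_extend hg f).summable⟩
      map_add' := fun f f' => lp.ext <| by
        have h := Function.extend_add g (⇑f) (⇑f') (0 : S → ℂ) 0
        rwa [add_zero] at h
      map_smul' := fun c f => lp.ext <| by
        have h := Function.extend_smul c g (⇑f) (0 : S → ℂ)
        rwa [smul_zero] at h }
    1
    (fun f => by
      rw [one_mul]
      exact lp.norm_le_of_tsum_le (by simp) (norm_nonneg f) (hasSum_norm_extend hg f).tsum_eq.le)

theorem pushforward_apply_self {g : S → S} (hg : Function.Injective g) (f : EllTwo S) (s : S) :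
    pushforward g hg f (g s) = f s :=
  hg.extend_apply f 0 s

theorem pushforward_apply_of_notMem {g : S → S} (hg : Function.Injective g) (f : EllTwo S) {t : S}
    (ht : t ∉ Set.range g) : pushforward g hg f t = 0 :=
  Function.extend_apply' (⇑f) (0 : S → ℂ) t ht

/-- The coordinate at `s` is the pairing with `δ_s`; moving the adjoint to the other side turns
`δ_s` into `δ_{g s}`. -/
theorem star_pushforward_apply {g : S → S} (hg : Function.Injective g) (f : EllTwo S) (s : S) :
    star (pushforward g hg) f s = f (g s) := by
  classical
  have h1 (f : EllTwo S) (s : S) : f s = ⟪lp.single (E := fun _ : S => ℂ) 2 s 1, f⟫_ℂ := by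
    rw [lp.inner_single_left]
    simp
  have h2 : pushforward g hg (lp.single 2 s 1) = lp.single 2 (g s) 1 := by
    refine lp.ext (funext fun t => ?_)
    by_cases ht : t ∈ Set.range g
    · obtain ⟨s', rfl⟩ := ht
      rw [pushforward_apply_self]
      simp [lp.single_apply, Pi.single_apply, hg.eq_iff]
    · rw [pushforward_apply_of_notMem hg _ ht, lp.single_apply_ne]
      rintro rfl
      exact ht ⟨s, rfl⟩
  rw [h1, ContinuousLinearMap.star_eq_adjoint, ContinuousLinearMap.adjoint_inner_right, h2, ← h1]

/-- The orthogonal projection of `ℓ²(S)` onto `ℓ²(X)`. -/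
def restriction (X : Set S) : EllTwo S →L[ℂ] EllTwo S :=
  have hs (f : EllTwo S) (s : S) : ‖X.indicator f s‖ ^ (2 : ℝ≥0∞).toReal ≤
      ‖f s‖ ^ (2 : ℝ≥0∞).toReal :=
    Real.rpow_le_rpow (norm_nonneg _) (norm_indicator_le_norm_self _ _) (by simp)
  have hf (f : EllTwo S) : HasSum (fun s => ‖f s‖ ^ (2 : ℝ≥0∞).toReal)
      (‖f‖ ^ (2 : ℝ≥0∞).toReal) := lp.hasSum_norm (by simp) f
  have hm (f : EllTwo S) : Summable fun s => ‖X.indicator f s‖ ^ (2 : ℝ≥0∞).toReal :=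
    Summable.of_nonneg_of_le (fun s => Real.rpow_nonneg (norm_nonneg _) _) (hs f) (hf f).summable
  LinearMap.mkContinuous
    { toFun := fun f => ⟨X.indicator f, memℓp_gen (hm f)⟩
      map_add' := fun f f' => lp.ext (Set.indicator_add X f f')
      map_smul' := fun c f => lp.ext (Set.indicator_const_smul X c f) }
    1
    (fun f => by
      rw [one_mul]
      refine lp.norm_le_of_tsum_le (by simp) (norm_nonneg f) ?_
      rw [← (hf f).tsum_eq]
      exact (hm f).tsum_le_tsum (hs f) (hf f).summable)

theorem restriction_apply_of_mem {X : Set S} (f : EllTwo S) {s : S} (hs : s ∈ X) :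
    restriction X f s = f s :=
  Set.indicator_of_mem hs f

theorem restriction_apply_of_notMem {X : Set S} (f : EllTwo S) {s : S} (hs : s ∉ X) :
    restriction X f s = 0 :=
  Set.indicator_of_notMem hs f

theorem restriction_mul (X Y : Set S) : restriction X * restriction Y = restriction (X ∩ Y) := by
  ext f s
  exact congrFun (Set.indicator_indicator X Y f) s

theorem isStarProjection_restriction (X : Set S) : IsStarProjection (restriction X) where
  isIdempotentElem := by rw [IsIdempotentElem, restriction_mul, Set.inter_self]
  isSelfAdjoint := by
    refine ((ContinuousLinearMap.eq_adjoint_iff _ _).2 fun f f' => ?_).symm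
    rw [lp.inner_eq_tsum, lp.inner_eq_tsum]
    refine tsum_congr fun s => ?_
    by_cases hs : s ∈ X
    · rw [restriction_apply_of_mem f hs, restriction_apply_of_mem f' hs]
    · rw [restriction_apply_of_notMem f hs, restriction_apply_of_notMem f' hs, inner_zero_left,
        inner_zero_right]

theorem star_pushforward_mul_self {g : S → S} (hg : Function.Injective g) :
    star (pushforward g hg) * pushforward g hg = 1 := by
  refine ContinuousLinearMap.ext fun f => lp.ext (funext fun s => ?_)
  exact (star_pushforward_apply hg _ s).trans (pushforward_apply_self hg f s)

theorem pushforward_mul {g h : S → S} (hg : Function.Injective g) (hh : Function.Injective h) :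
    pushforward g hg * pushforward h hh = pushforward (g ∘ h) (hg.comp hh) := by
  refine ContinuousLinearMap.ext fun f => lp.ext (funext fun t => ?_)
  change pushforward g hg (pushforward h hh f) t = _
  by_cases ht : t ∈ Set.range g
  · obtain ⟨s, rfl⟩ := ht
    rw [pushforward_apply_self]
    by_cases hs : s ∈ Set.range h
    · obtain ⟨r, rfl⟩ := hs
      rw [pushforward_apply_self]
      exact (pushforward_apply_self (hg.comp hh) f r).symm
    · rw [pushforward_apply_of_notMem hh f hs, pushforward_apply_of_notMem]
      rintro ⟨r, hr⟩
      exact hs ⟨r, hg hr⟩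
  · rw [pushforward_apply_of_notMem hg _ ht, pushforward_apply_of_notMem]
    rintro ⟨r, rfl⟩
    exact ht ⟨h r, rfl⟩

theorem pushforward_conj_restriction {g : S → S} (hg : Function.Injective g) (X : Set S) :
    pushforward g hg * restriction X * star (pushforward g hg) = restriction (g '' X) := by
  refine ContinuousLinearMap.ext fun f => lp.ext (funext fun t => ?_)
  change pushforward g hg (restriction X (star (pushforward g hg) f)) t = _
  by_cases ht : t ∈ Set.range g
  · obtain ⟨s, rfl⟩ := ht
    rw [pushforward_apply_self]
    by_cases hs : s ∈ X
    · rw [restriction_apply_of_mem _ hs, star_pushforward_apply,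
        restriction_apply_of_mem f (Set.mem_image_of_mem g hs)]
    · rw [restriction_apply_of_notMem _ hs, restriction_apply_of_notMem]
      rwa [hg.mem_set_image]
  · rw [pushforward_apply_of_notMem hg _ ht, restriction_apply_of_notMem]
    rintro ⟨s, -, rfl⟩
    exact ht ⟨s, rfl⟩

open Classical in
theorem restriction_single_of_mem {X : Set S} {r : S} (hr : r ∈ X) :
    restriction X (lp.single (E := fun _ : S => ℂ) 2 r 1) = lp.single 2 r 1 := by
  refine lp.ext (funext fun s => ?_)
  by_cases hs : s ∈ X
  · exact restriction_apply_of_mem _ hs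
  · rw [restriction_apply_of_notMem _ hs, lp.single_apply_ne]
    rintro rfl
    exact hs hr

open Classical in
theorem restriction_single_of_notMem {X : Set S} {r : S} (hr : r ∉ X) :
    restriction X (lp.single (E := fun _ : S => ℂ) 2 r 1) = 0 := by
  refine lp.ext (funext fun s => ?_)
  by_cases hs : s ∈ X
  · rw [restriction_apply_of_mem _ hs, lp.single_apply_ne]
    · rfl
    · rintro rfl
      exact hr hs
  · exact restriction_apply_of_notMem _ hs

theorem restriction_empty : restriction (∅ : Set S) = 0 := by
  refine ContinuousLinearMap.ext fun f => lp.ext (funext fun s => ?_)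
  exact restriction_apply_of_notMem f (Set.notMem_empty s)

theorem restriction_univ : restriction (Set.univ : Set S) = 1 := by
  refine ContinuousLinearMap.ext fun f => lp.ext (funext fun s => ?_)
  exact restriction_apply_of_mem f (Set.mem_univ s)

instance [Nonempty S] : Nontrivial (EllTwo S) := by
  classical
  obtain ⟨s⟩ := ‹Nonempty S›
  refine ⟨⟨lp.single 2 s 1, 0, fun h => ?_⟩⟩
  have h1 := congrArg norm h
  rw [lp.norm_single (by simp)] at h1
  simp at h1

variable (S) [Monoid S] [IsLeftCancelMul S]

/-- The left regular representation of `S` on `ℓ²(S)`. -/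
def regular : LiRepresentation S where
  H := EllTwo S
  family :=
    { v := fun p => pushforward (fun s => p * s) (mul_right_injective p)
      e := fun X => restriction X.1
      isometry := fun p => star_pushforward_mul_self _
      projection := fun X => isStarProjection_restriction X.1
      v_mul := fun p q => by
        rw [pushforward_mul]
        congr 1
        funext s
        exact (mul_assoc p q s).symm
      conj := fun p X => pushforward_conj_restriction _ X.1
      e_empty := restriction_empty
      e_univ := restriction_univ
      e_mul := fun X Y => restriction_mul X.1 Y.1 }

variable {S}

open Classical in
/-- The basis vector at `r` in the space of the left regular representation. -/
def basisVec (r : S) : (regular S).H := lp.single (E := fun _ : S => ℂ) 2 r 1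

theorem norm_basisVec (r : S) : ‖basisVec r‖ = 1 := by
  classical
  exact (lp.norm_single (E := fun _ : S => ℂ) (by simp) r (1 : ℂ)).trans norm_one

theorem extend_regular_proj_of_mem {X : ConstructibleIdeal S} {r : S} (hr : r ∈ X.1) :
    extend (regular S) (proj X) (basisVec r) = basisVec r :=
  restriction_single_of_mem hr

theorem extend_regular_proj_of_notMem {X : ConstructibleIdeal S} {r : S} (hr : r ∉ X.1) :
    extend (regular S) (proj X) (basisVec r) = 0 :=
  restriction_single_of_notMem hr

end Regular

/-! ### Cutoffs in the diagonal that kill a monomial -/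

section Cutoff

variable {S : Type u} [Monoid S] [IsLeftCancelMul S]

theorem proj_mul (X Y : ConstructibleIdeal S) : proj X * proj Y = proj (X.inter Y) :=
  (universalFamily S).e_mul X Y

theorem isStarProjection_proj (X : ConstructibleIdeal S) : IsStarProjection (proj X) :=
  (universalFamily S).projection X

theorem isom_conj_proj (p : S) (X : ConstructibleIdeal S) :
    isom p * proj X * star (isom p) = proj (X.translate p) :=
  (universalFamily S).conj p X

theorem proj_mul_comm (X Y : ConstructibleIdeal S) : proj X * proj Y = proj Y * proj X := by
  rw [proj_mul, proj_mul]
  exact congrArg proj (Subtype.ext (Set.inter_comm _ _))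

/-- The `e_X` commute with each other, so the diagonal lies in their centralizer, which is closed.
The closed algebra they generate also lies in their double centralizer. -/
theorem diagonal_mul_comm {a b : FullCStar S} (ha : a ∈ diagonal S) (hb : b ∈ diagonal S) :
    a * b = b * a := by
  have h1 : diagonal S ≤ StarSubalgebra.centralizer ℂ (Set.range (proj (S := S))) := by
    refine StarSubalgebra.topologicalClosure_minimal (StarAlgebra.adjoin_le ?_)
      (Set.isClosed_centralizer _)
    rintro _ ⟨X, rfl⟩
    refine (StarSubalgebra.mem_centralizer_iff ℂ).2 ?_
    rintro _ ⟨Y, rfl⟩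
    rw [(isStarProjection_proj Y).isSelfAdjoint.star_eq]
    exact ⟨proj_mul_comm Y X, proj_mul_comm Y X⟩
  have h2 := StarSubalgebra.topologicalClosure_adjoin_le_centralizer_centralizer ℂ _ ha
  exact (((StarSubalgebra.mem_centralizer_iff ℂ).1 h2 b (h1 hb)).1).symm

variable (S) in
/-- The diagonal is a commutative C*-algebra. -/
abbrev diagonalCommCStarAlgebra : CommCStarAlgebra (diagonal S) where
  mul_comm a b := Subtype.ext (diagonal_mul_comm a.2 b.2)

/-- A contraction `f` in the diagonal which fixes the basis vector at `r` in the left regular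
representation. -/
structure IsCutoff (r : S) (f : FullCStar S) : Prop where
  mem : f ∈ diagonal S
  norm_le : ‖f‖ ≤ 1
  apply : extend (regular S) f (basisVec r) = basisVec r

theorem IsCutoff.one (r : S) : IsCutoff r (1 : FullCStar S) where
  mem := one_mem _
  norm_le := (IsStarProjection.one (FullCStar S)).norm_le
  apply := by rw [map_one]; rfl

theorem IsCutoff.mul {r : S} {f g : FullCStar S} (hf : IsCutoff r f) (hg : IsCutoff r g) :
    IsCutoff r (f * g) where
  mem := mul_mem hf.mem hg.mem
  norm_le := (norm_mul_le f g).trans (mul_le_one₀ hf.norm_le (norm_nonneg g) hg.norm_le)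
  apply := by
    rw [map_mul]
    exact (congrArg (extend (regular S) f) hg.apply).trans hf.apply

theorem isCutoff_proj {r : S} {X : ConstructibleIdeal S} (hr : r ∈ X.1) : IsCutoff r (proj X) where
  mem := proj_mem_diagonal X
  norm_le := (isStarProjection_proj X).norm_le
  apply := extend_regular_proj_of_mem hr

theorem isCutoff_one_sub_proj {r : S} {X : ConstructibleIdeal S} (hr : r ∉ X.1) :
    IsCutoff r (1 - proj X) where
  mem := sub_mem (one_mem _) (proj_mem_diagonal X)
  norm_le := (isStarProjection_proj X).one_sub.norm_le
  apply := by
    rw [map_sub, map_one, sub_apply, extend_regular_proj_of_notMem hr, sub_zero]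
    rfl

theorem proj_principal_mul_isom (p : S) : proj (.principal p) * isom p = isom p := by
  rw [← isom_mul_star, mul_assoc, star_isom_mul_isom, mul_one]

theorem proj_translate_mul_isom (p : S) (X : ConstructibleIdeal S) :
    proj (X.translate p) * isom p = isom p * proj X := by
  rw [← isom_conj_proj, mul_assoc, star_isom_mul_isom, mul_one]

/-- `p⁻¹X` as a constructible right ideal. -/
def ConstructibleIdeal.pullback (p : S) (X : ConstructibleIdeal S) : ConstructibleIdeal S :=
  ⟨(fun s => p * s) ⁻¹' X.1, .preimage p X.2⟩

/-- From `p(p⁻¹X) = pS ∩ X` one gets `v_p e_{p⁻¹X} v_p* = v_p v_p* e_X`; multiply by `v_p*` on the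
left. -/
theorem proj_pullback_mul_star_isom (p : S) (X : ConstructibleIdeal S) :
    proj (X.pullback p) * star (isom p) = star (isom p) * proj X := by
  have h : ConstructibleIdeal.translate p (X.pullback p) =
      ConstructibleIdeal.inter (.principal p) X :=
    Subtype.ext <| by
      change (fun s => p * s) '' ((fun s => p * s) ⁻¹' X.1) = principalIdeal p ∩ X.1
      rw [Set.image_preimage_eq_range_inter]
      rfl
  have h1 := isom_conj_proj p (X.pullback p)
  rw [h, ← proj_mul, ← isom_mul_star] at h1
  have h2 := congrArg (star (isom p) * ·) h1
  simpa only [← mul_assoc, star_isom_mul_isom, one_mul] using h2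

/-- Carrying `e_{r(a⁻¹bS)}` to the right past `v_r` and `v_a*` turns it into `e_{bS}`, which `v_b`
absorbs. -/
theorem one_sub_proj_mul_isom_mul (r a b : S) :
    (1 - proj (((ConstructibleIdeal.principal b).pullback a).translate r)) *
      (isom r * (star (isom a) * isom b)) = 0 := by
  have h : proj (((ConstructibleIdeal.principal b).pullback a).translate r) *
      (isom r * (star (isom a) * isom b)) = isom r * (star (isom a) * isom b) := by
    rw [← mul_assoc, proj_translate_mul_isom, mul_assoc, ← mul_assoc (proj _),
      proj_pullback_mul_star_isom, mul_assoc (star _), proj_principal_mul_isom]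
  rw [sub_mul, one_mul, h, sub_self]

/-- For `r = pa`, `e_{rS} v_p = v_r v_a* v_p* v_p = v_r v_a*`. The right half is the adjoint of the
same identity for `r = qb`. -/
theorem proj_mul_isom_mul_proj {p q r a b : S} (ha : p * a = r) (hb : q * b = r) :
    proj (.principal r) * (isom p * star (isom q)) * proj (.principal r) =
      isom r * (star (isom a) * isom b) * star (isom r) := by
  have h1 {p a : S} (ha : p * a = r) : proj (.principal r) * isom p = isom r * star (isom a) := by
    rw [← isom_mul_star, mul_assoc]
    nth_rw 2 [← ha]
    rw [← isom_mul, star_mul, mul_assoc, star_isom_mul_isom, mul_one]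
  have h2 := congrArg star (h1 hb)
  rw [star_mul, star_mul, star_star, (isStarProjection_proj _).isSelfAdjoint.star_eq] at h2
  rw [← mul_assoc, h1 ha, mul_assoc, h2]
  simp only [mul_assoc]

/-- By left cancellation, `r ∈ r(a⁻¹bS)` would put `1` into `a⁻¹bS`, i.e. `a` into `bS`. This makes
`1 - e_{r(a⁻¹bS)}` fix `δ_r`. -/
theorem notMem_translate_pullback {r a b : S} (h : a ∉ principalIdeal b) :
    r ∉ (((ConstructibleIdeal.principal b).pullback a).translate r).1 := by
  rintro ⟨s, hs, hrs⟩
  have h1 : s = 1 := mul_left_cancel (a := r) (hrs.trans (mul_one r).symm)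
  subst h1
  have h2 : a * 1 ∈ principalIdeal b := hs
  rw [mul_one] at h2
  exact h h2

/-- The cutoff is `(1 - e_{r(a⁻¹bS)}) e_{rS}`: the second factor compresses the monomial to `v_r
v_a* v_b v_r*`, which the first annihilates. The adjoint monomial is included because the hypothesis
on `a` and `b` is not symmetric. -/
theorem exists_isCutoff_of_notMem {p q r a b : S} (ha : p * a = r) (hb : q * b = r)
    (h : a ∉ principalIdeal b) :
    ∃ f, IsCutoff r f ∧ f * (isom p * star (isom q)) * f = 0 ∧
      f * (isom q * star (isom p)) * f = 0 := by
  have hg := isCutoff_one_sub_proj (notMem_translate_pullback (r := r) h)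
  have hr : IsCutoff r (proj (.principal r)) := isCutoff_proj ⟨1, mul_one r⟩
  have h0 := one_sub_proj_mul_isom_mul r a b
  have hsa := (isStarProjection_proj
    (((ConstructibleIdeal.principal b).pullback a).translate r)).one_sub.isSelfAdjoint.star_eq
  set g := 1 - proj (((ConstructibleIdeal.principal b).pullback a).translate r)
  have hc := diagonal_mul_comm hg.mem hr.mem
  have h1 (m : FullCStar S) : g * proj (.principal r) * m * (g * proj (.principal r)) =
      g * (proj (.principal r) * m * proj (.principal r)) * g := by
    nth_rw 2 [hc]
    simp only [mul_assoc]
  have h0' := congrArg star h0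
  rw [star_zero, star_mul, hsa] at h0'
  simp only [star_mul, star_star] at h0'
  -- The first compressed monomial is killed by `g` from the left (`h0`), its adjoint by `g` from
  -- the right (`h0'`).
  refine ⟨_, hg.mul hr, ?_, ?_⟩
  · rw [h1, proj_mul_isom_mul_proj ha hb, ← mul_assoc g, h0, zero_mul, zero_mul]
  · rw [h1, proj_mul_isom_mul_proj hb ha, mul_assoc, mul_assoc (isom r), mul_assoc (isom r), h0',
      mul_zero, mul_zero]

end Cutoff

/-! ### Removing the part of an element that `E` kills -/

section Expectation

variable {S : Type u} [Monoid S] [IsCancelMul S]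

/-- As `aS = bS`, `a = bs` with `s` a unit. Two uses of (C1) move the unit to the far left: `pa =
pbs = pyb = zpb`. Cancelling `b` in `zpb = qb` gives `zp = q`. -/
theorem exists_eq_unit_mul (hC1 : SatisfiesC1 S) {p q a b : S} (h : p * a = q * b)
    (hab : a ∈ principalIdeal b) (hba : b ∈ principalIdeal a) : ∃ x : Sˣ, p = x * q := by
  obtain ⟨s, rfl⟩ := hab
  obtain ⟨t, ht⟩ := hba
  have hst : s * t = 1 := mul_left_cancel (a := b) (by simpa [mul_assoc] using ht)
  have hts : t * s = 1 := mul_left_cancel (a := s) (by rw [← mul_assoc, hst, one_mul, mul_one])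
  obtain ⟨y, hy⟩ := hC1 b ⟨s, t, hst, hts⟩
  have hy' : b * s = y * b := hy
  obtain ⟨z, hz⟩ := hC1 p y
  have hq : z * p = q := by
    refine mul_right_cancel (b := b) ?_
    rw [← hz, mul_assoc, ← hy']
    exact h
  exact ⟨z⁻¹, by rw [← hq, Units.inv_mul_cancel_left]⟩

/-- If `r` lies outside `pS` or outside `qS`, then `1 - e_{pS}` or `1 - e_{qS}` works, as `v_p =
e_{pS} v_p` and `v_q* = v_q* e_{qS}`. Otherwise `r = pa = qb`, and `p ≁ q` rules out `aS = bS`. -/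
theorem exists_isCutoff_of_not (hC1 : SatisfiesC1 S) (r : S) {p q : S}
    (h : ¬ ∃ x : Sˣ, p = x * q) :
    ∃ f, IsCutoff r f ∧ f * (isom p * star (isom q)) * f = 0 := by
  by_cases hp : r ∈ principalIdeal p
  · by_cases hq : r ∈ principalIdeal q
    · obtain ⟨a, ha⟩ := hp
      obtain ⟨b, hb⟩ := hq
      by_cases hab : a ∈ principalIdeal b
      · have hba : b ∉ principalIdeal a := fun hba =>
          h (exists_eq_unit_mul hC1 (ha.trans hb.symm) hab hba)
        -- With `p` and `q` interchanged, the second conclusion is the one about `v_p v_q*`.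
        obtain ⟨f, hf, -, hf'⟩ := exists_isCutoff_of_notMem hb ha hba
        exact ⟨f, hf, hf'⟩
      · obtain ⟨f, hf, hf', -⟩ := exists_isCutoff_of_notMem ha hb hab
        exact ⟨f, hf, hf'⟩
    · refine ⟨_, isCutoff_one_sub_proj (X := .principal q) hq, ?_⟩
      have h1 := congrArg star (proj_principal_mul_isom q)
      rw [star_mul, (isStarProjection_proj _).isSelfAdjoint.star_eq] at h1
      rw [mul_assoc, mul_assoc, mul_sub, mul_one, h1, sub_self, mul_zero, mul_zero]
  · refine ⟨_, isCutoff_one_sub_proj (X := .principal p) hp, ?_⟩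
    rw [← mul_assoc, sub_mul, one_mul, proj_principal_mul_isom, sub_self, zero_mul, zero_mul]

/-- Off-diagonal parts of elements in the span of the monomials are removed by a cutoff. -/
theorem exists_isCutoff (hC1 : SatisfiesC1 S) {E : FullCStar S →ₗ[ℂ] innerCore S}
    (hE : IsConditionalExpectation (innerCore S).subtype E)
    (hE_not : ∀ p q : S, (¬ ∃ x : Sˣ, p = x * q) →
      (E (isom p * star (isom q)) : FullCStar S) = 0)
    (r : S) {a : FullCStar S} (ha : a ∈ monomialSpan S) :
    ∃ f, IsCutoff r f ∧ f * (a - E a) * f = 0 := by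
  induction ha using Submodule.span_induction with
  | mem a ha =>
    obtain ⟨⟨p, q⟩, rfl⟩ := ha
    by_cases h : ∃ x : Sˣ, p = x * q
    · obtain ⟨x, rfl⟩ := h
      have h1 := congrArg Subtype.val (hE.map_coe ⟨_, monomial_mem_innerCore x q⟩)
      -- A monomial with `p ∼ q` lies in the inner core and is fixed by `E`, so nothing has to be
      -- cut off.
      refine ⟨1, .one r, ?_⟩
      rw [one_mul, mul_one, sub_eq_zero]
      exact h1.symm
    · obtain ⟨f, hf, hf'⟩ := exists_isCutoff_of_not hC1 r h
      exact ⟨f, hf, by simpa only [hE_not p q h, sub_zero] using hf'⟩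
  | zero => exact ⟨1, .one r, by simp⟩
  | add a b _ _ ha hb =>
    obtain ⟨f, hf, hf'⟩ := ha
    obtain ⟨g, hg, hg'⟩ := hb
    -- As `f` and `g` commute, either of them can be placed innermost, next to the summand it kills.
    refine ⟨f * g, hf.mul hg, ?_⟩
    have hfg := diagonal_mul_comm hf.mem hg.mem
    have h1 : f * g * (a - E a) * (f * g) = g * (f * (a - E a) * f) * g := by
      nth_rw 1 [hfg]
      simp only [mul_assoc]
    have h2 : f * g * (b - E b) * (f * g) = f * (g * (b - E b) * g) * f := by
      nth_rw 2 [hfg]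
      simp only [mul_assoc]
    have h3 : a + b - (E (a + b) : FullCStar S) = (a - E a) + (b - E b) := by
      rw [map_add]
      exact add_sub_add_comm a b _ _
    rw [h3, mul_add, add_mul, h1, h2, hf', hg']
    simp
  | smul c a _ ha =>
    obtain ⟨f, hf, hf'⟩ := ha
    refine ⟨f, hf, ?_⟩
    have h1 : c • a - (E (c • a) : FullCStar S) = c • (a - E a) := by
      rw [map_smul]
      exact (smul_sub c a _).symm
    rw [h1, mul_smul_comm, smul_mul_assoc, hf', smul_zero]

end Expectation

/-! ### Characters of the diagonal and norms on basis vectors -/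

section DiagonalNorm

open WeakDual

variable {S : Type u} [Monoid S] [IsLeftCancelMul S]

theorem coe_diagProj (X : ConstructibleIdeal S) : (diagProj X : FullCStar S) = proj X := rfl

theorem character_proj_eq_zero_or_one (χ : characterSpace ℂ (diagonal S))
    (X : ConstructibleIdeal S) : χ (diagProj X) = 0 ∨ χ (diagProj X) = 1 := by
  have h : diagProj X * diagProj X = diagProj X :=
    Subtype.ext (isStarProjection_proj X).isIdempotentElem
  have h1 := congrArg χ h
  rw [map_mul] at h1
  exact (IsIdempotentElem.iff_eq_zero_or_one (p := χ (diagProj X))).1 h1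

/-- By multiplicativity `χ` is `1` on the projection of `pS ∩ qS`. So this ideal is not empty, and
the LCM property makes it principal. -/
theorem exists_character_proj_inter (hLCM : IsRightLCM S) (χ : characterSpace ℂ (diagonal S))
    {p q : S} (hp : χ (diagProj (.principal p)) = 1) (hq : χ (diagProj (.principal q)) = 1) :
    ∃ r : S, χ (diagProj (.principal r)) = 1 ∧
      principalIdeal p ∩ principalIdeal q = principalIdeal r := by
  have h : diagProj (.principal p) * diagProj (.principal q) =
      diagProj (ConstructibleIdeal.inter (.principal p) (.principal q)) :=
    Subtype.ext (proj_mul _ _)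
  have h1 := congrArg χ h
  rw [map_mul, hp, hq, one_mul] at h1
  rcases Set.eq_empty_or_nonempty (principalIdeal p ∩ principalIdeal q) with h0 | h0
  · have h2 : ConstructibleIdeal.inter (.principal p) (.principal q) =
        (ConstructibleIdeal.empty : ConstructibleIdeal S) := Subtype.ext h0
    have h3 : diagProj (ConstructibleIdeal.empty : ConstructibleIdeal S) = 0 :=
      Subtype.ext (universalFamily S).e_empty
    rw [h2, h3, map_zero] at h1
    exact absurd h1 one_ne_zero
  · obtain ⟨r, hr⟩ := hLCM p q h0
    have h2 : ConstructibleIdeal.inter (.principal p) (.principal q) =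
        (ConstructibleIdeal.principal r : ConstructibleIdeal S) := Subtype.ext hr
    rw [h2] at h1
    exact ⟨r, h1.symm, hr⟩

theorem character_proj_of_mem (χ : characterSpace ℂ (diagonal S)) {p r : S}
    (hr : χ (diagProj (.principal r)) = 1) (h : r ∈ principalIdeal p) :
    χ (diagProj (.principal p)) = 1 := by
  have h1 : diagProj (.principal p) * diagProj (.principal r) = diagProj (.principal r) := by
    refine Subtype.ext ((proj_mul _ _).trans (congrArg proj (Subtype.ext ?_)))
    refine Set.inter_eq_right.2 ?_
    obtain ⟨s, rfl⟩ := h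
    rintro _ ⟨t, rfl⟩
    exact ⟨s * t, (mul_assoc p s t).symm⟩
  have h2 := congrArg χ h1
  rwa [map_mul, hr, mul_one] at h2

/-- The linear span of the projections `e_{pS}` in the diagonal. -/
def principalSpan (S : Type u) [Monoid S] [IsLeftCancelMul S] : Submodule ℂ (diagonal S) :=
  Submodule.span ℂ (Set.range fun p : S => diagProj (.principal p))

/-- On finitely many projections `e_{pS}`, each character of the diagonal is given by a basis
vector of the left regular representation. -/
theorem exists_character_eq (hLCM : IsRightLCM S) (χ : characterSpace ℂ (diagonal S))
    {d : diagonal S} (hd : d ∈ principalSpan S) :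
    ∃ r : S, χ (diagProj (.principal r)) = 1 ∧ ∀ s ∈ principalIdeal r,
      χ (diagProj (.principal s)) = 1 →
        extend (regular S) d (basisVec s) = χ d • basisVec s := by
  have h1 : χ (diagProj (.principal (1 : S))) = 1 := by
    have h : diagProj (.principal (1 : S)) = 1 := by
      refine Subtype.ext ?_
      rw [coe_diagProj, ← isom_mul_star, isom_one, star_one, mul_one]
      rfl
    rw [h, map_one]
  induction hd using Submodule.span_induction with
  | mem d hd =>
    obtain ⟨p, rfl⟩ := hd
    -- If `χ(e_{pS}) = 0`, then no `s` with `χ(e_{sS}) = 1` lies in `pS`, so `r = 1` imposes nothing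
    -- further. If `χ(e_{pS}) = 1`, then `r = p` forces `s ∈ pS`.
    rcases character_proj_eq_zero_or_one χ (.principal p) with h | h
    · refine ⟨1, h1, fun s _ hs => ?_⟩
      rw [h, zero_smul]
      refine extend_regular_proj_of_notMem fun hsp => ?_
      exact zero_ne_one (h.symm.trans (character_proj_of_mem χ hs hsp))
    · refine ⟨p, h, fun s hs _ => ?_⟩
      rw [h, one_smul]
      exact extend_regular_proj_of_mem hs
  | zero =>
    refine ⟨1, h1, fun s _ _ => ?_⟩
    rw [map_zero, zero_smul, ZeroMemClass.coe_zero, map_zero, zero_apply]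
  | add d d' _ _ hd hd' =>
    obtain ⟨r, hr, h⟩ := hd
    obtain ⟨r', hr', h'⟩ := hd'
    -- Having the claim for all admissible `s` in `rS`, not just for `r`, lets it be restricted to
    -- `rS ∩ r'S = tS`.
    obtain ⟨t, ht, hrt⟩ := exists_character_proj_inter hLCM χ hr hr'
    refine ⟨t, ht, fun s hs hs1 => ?_⟩
    rw [← hrt] at hs
    rw [map_add, add_smul, ← h s hs.1 hs1, ← h' s hs.2 hs1, AddMemClass.coe_add, map_add,
      add_apply]
  | smul c d _ hd =>
    obtain ⟨r, hr, h⟩ := hd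
    refine ⟨r, hr, fun s hs hs1 => ?_⟩
    have h2 : ((c • d : diagonal S) : FullCStar S) = c • (d : FullCStar S) := rfl
    rw [map_smul, smul_assoc, ← h s hs hs1, h2, map_smul, smul_apply]

/-- By Gelfand theory `‖d‖` is the supremum of the `|χ(d)|`, and each of these equals `‖d δ_r‖` for
an `r` depending on `χ` and `d`. -/
theorem norm_le_of_forall_basisVec (hLCM : IsRightLCM S) {d : diagonal S}
    (hd : d ∈ principalSpan S) {M : ℝ} (hM : 0 ≤ M)
    (h : ∀ r : S, ‖extend (regular S) d (basisVec r)‖ ≤ M) : ‖d‖ ≤ M := by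
  let := diagonalCommCStarAlgebra S
  rw [← (AddMonoidHomClass.isometry_iff_norm _).1 (gelfandTransform_isometry (diagonal S)) d]
  refine (ContinuousMap.norm_le _ hM).2 fun χ => ?_
  obtain ⟨r, hr, hχ⟩ := exists_character_eq hLCM χ hd
  have h1 := h r
  rwa [hχ r ⟨1, mul_one r⟩ hr, norm_smul, norm_basisVec, mul_one] at h1

/-- By commutativity `f d f = d f²`, and `f²` fixes the unit vector `δ_r`. -/
theorem norm_apply_basisVec_le {r : S} {f : FullCStar S} (hf : IsCutoff r f) (d : diagonal S) :
    ‖extend (regular S) d (basisVec r)‖ ≤ ‖f * d * f‖ := by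
  have h1 : f * d * f = d * (f * f) := by
    rw [diagonal_mul_comm hf.mem d.2, mul_assoc]
  have h2 : extend (regular S) (f * d * f) (basisVec r) =
      extend (regular S) d (basisVec r) := by
    rw [h1, map_mul]
    exact congrArg (extend (regular S) d) (hf.mul hf).apply
  rw [← h2]
  refine (ContinuousLinearMap.le_opNorm _ _).trans ?_
  rw [norm_basisVec, mul_one]
  exact NonUnitalStarAlgHom.norm_apply_le (extend (regular S)) _

/-- Converts the order `v_x e_{qS}`, in which `E` delivers its values, to the order in which `Φ₀` is
prescribed. -/
theorem coreIsom_mul_coreProj (x : Sˣ) (q : S) :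
    coreIsom x * coreProj q = coreProj ((x : S) * q) * coreIsom x := by
  have h := proj_translate_mul_isom (x : S) (.principal q)
  have h1 : ConstructibleIdeal.translate (x : S) (.principal q) = .principal ((x : S) * q) :=
    Subtype.ext <| by
      refine (Set.range_comp _ _).symm.trans (congrArg Set.range (funext fun s => ?_))
      exact (mul_assoc (x : S) q s).symm
  rw [h1] at h
  exact Subtype.ext h.symm

end DiagonalNorm

/-! ### The norm estimate and the conclusion -/

section Main

variable {S : Type u} [Monoid S] [IsCancelMul S]

/-- On a monomial the result is `e_{qS}` if `p = q` and `0` otherwise. Staying in the algebraic span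
matters, since the comparison of characters with basis vectors handles finite combinations. -/
theorem expectation_mem_principalSpan {E : FullCStar S →ₗ[ℂ] innerCore S}
    (hE_eq : ∀ (p q : S) (x : Sˣ), p = x * q →
      (E (isom p * star (isom q)) : FullCStar S) = isom (x : S) * proj (.principal q))
    (hE_not : ∀ p q : S, (¬ ∃ x : Sˣ, p = x * q) →
      (E (isom p * star (isom q)) : FullCStar S) = 0)
    {Φ₀ : innerCore S →ₗ[ℂ] diagonal S}
    (hΦ₀_one : ∀ q : S, Φ₀ (coreProj q * coreIsom 1) = diagProj (.principal q))
    (hΦ₀_ne : ∀ (q : S) (x : Sˣ), x ≠ 1 → Φ₀ (coreProj q * coreIsom x) = 0)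
    {a : FullCStar S} (ha : a ∈ monomialSpan S) : Φ₀ (E a) ∈ principalSpan S := by
  induction ha using Submodule.span_induction with
  | mem a ha =>
    obtain ⟨⟨p, q⟩, rfl⟩ := ha
    by_cases h : ∃ x : Sˣ, p = x * q
    · obtain ⟨x, hx⟩ := h
      have h1 : E (isom p * star (isom q)) = coreProj ((x : S) * q) * coreIsom x :=
        (Subtype.ext (hE_eq p q x hx)).trans (coreIsom_mul_coreProj x q)
      rw [h1]
      by_cases hx1 : x = 1
      · subst hx1
        rw [hΦ₀_one]
        exact Submodule.subset_span ⟨_, rfl⟩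
      · rw [hΦ₀_ne _ x hx1]
        exact zero_mem _
    · have h1 : E (isom p * star (isom q)) = 0 := Subtype.ext (hE_not p q h)
      rw [h1, map_zero]
      exact zero_mem _
  | zero => simp
  | add a b _ _ ha hb =>
    rw [map_add, map_add]
    exact add_mem ha hb
  | smul c a _ ha =>
    rw [map_smul, map_smul]
    exact Submodule.smul_mem _ c ha

theorem norm_expectation_le (hLCM : IsRightLCM S) (hC1 : SatisfiesC1 S)
    {E : FullCStar S →ₗ[ℂ] innerCore S}
    (hE : IsConditionalExpectation (innerCore S).subtype E)
    (hE_eq : ∀ (p q : S) (x : Sˣ), p = x * q →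
      (E (isom p * star (isom q)) : FullCStar S) = isom (x : S) * proj (.principal q))
    (hE_not : ∀ p q : S, (¬ ∃ x : Sˣ, p = x * q) →
      (E (isom p * star (isom q)) : FullCStar S) = 0)
    {Φ₀ : innerCore S →ₗ[ℂ] diagonal S}
    (hΦ₀ : IsConditionalExpectation (StarSubalgebra.inclusion (diagonal_le_innerCore hLCM)) Φ₀)
    (hΦ₀_one : ∀ q : S, Φ₀ (coreProj q * coreIsom 1) = diagProj (.principal q))
    (hΦ₀_ne : ∀ (q : S) (x : Sˣ), x ≠ 1 → Φ₀ (coreProj q * coreIsom x) = 0)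
    {B : Type w} [NonUnitalCStarAlgebra B] (π : FullCStar S →⋆ₙₐ[ℂ] B)
    (hπ : Set.InjOn π (innerCore S)) (a : FullCStar S) : ‖Φ₀ (E a)‖ ≤ ‖π a‖ := by
  have hcE : Continuous E := AddMonoidHomClass.continuous_of_bound E 1 fun a => by
    rw [one_mul]
    exact hE.norm_le a
  have hcΦ : Continuous Φ₀ := AddMonoidHomClass.continuous_of_bound Φ₀ 1 fun a => by
    rw [one_mul]
    exact hΦ₀.norm_le a
  have hcπ : Continuous π := AddMonoidHomClass.continuous_of_bound π 1 fun a => by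
    rw [one_mul]
    exact NonUnitalStarAlgHom.norm_apply_le π a
  -- This is where injectivity on the inner core enters: injective `*`-homomorphisms are isometric.
  have hnorm (c : innerCore S) : ‖π c‖ = ‖c‖ :=
    NonUnitalStarAlgHom.norm_map
      (π.comp ((innerCore S).subtype : innerCore S →⋆ₙₐ[ℂ] FullCStar S))
      (fun c c' h => Subtype.ext (hπ c.2 c'.2 h)) c
  refine closure_minimal (s := (monomialSpan S : Set (FullCStar S)))
    (t := {a | ‖Φ₀ (E a)‖ ≤ ‖π a‖}) (fun a ha => ?_)
    (isClosed_le (hcΦ.comp hcE).norm hcπ.norm) (mem_closure_monomialSpan hLCM a)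
  refine norm_le_of_forall_basisVec hLCM
    (expectation_mem_principalSpan hE_eq hE_not hΦ₀_one hΦ₀_ne ha)
    (norm_nonneg _) fun r => ?_
  obtain ⟨f, hf, hfa⟩ := exists_isCutoff hC1 hE hE_not r ha
  -- In the form `f a f = f E(a) f`, the cutoff identity trades `E a`, on which `π` is isometric,
  -- for `a` itself.
  rw [mul_sub, sub_mul, sub_eq_zero] at hfa
  let f' : diagonal S := ⟨f, hf.mem⟩
  let g : innerCore S := StarSubalgebra.inclusion (diagonal_le_innerCore hLCM) f'
  calc ‖extend (regular S) (Φ₀ (E a)) (basisVec r)‖ ≤ ‖f * (Φ₀ (E a) : FullCStar S) * f‖ :=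
        norm_apply_basisVec_le hf _
    _ = ‖Φ₀ (g * E a * g)‖ := (congrArg norm (hΦ₀.bilinear f' (E a) f')).symm
    _ ≤ ‖g * E a * g‖ := hΦ₀.norm_le _
    _ = ‖π (f * (E a : FullCStar S) * f)‖ := (hnorm (g * E a * g)).symm
    _ = ‖π f * π a * π f‖ := by rw [← hfa, map_mul, map_mul]
    _ ≤ ‖π f‖ * ‖π a‖ * ‖π f‖ := norm_mul₃_le
    _ ≤ 1 * ‖π a‖ * 1 := by
      have h1 : ‖π f‖ ≤ 1 := (NonUnitalStarAlgHom.norm_apply_le π f).trans hf.norm_le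
      gcongr
    _ = ‖π a‖ := by rw [one_mul, mul_one]

end Main

end

end RightLCM

theorem mainTheorem5 {S : Type u} [Monoid S] [IsCancelMul S] (hLCM : IsRightLCM S)
    (hC1 : SatisfiesC1 S) {Γ : Type v} [Group Γ] (ι : UnitQuotient hC1 →* Γ)
    (hι : Function.Injective ι) (hgen : Subgroup.closure (Set.range ι) = ⊤)
    (hΦ : IsFaithful (innerCoreExpectation hLCM hC1 ι hι hgen))
    (Φ₀ : innerCore S →ₗ[ℂ] diagonal S)
    (hΦ₀ : IsConditionalExpectation (StarSubalgebra.inclusion (diagonal_le_innerCore hLCM)) Φ₀)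
    (hΦ₀_faithful : IsFaithful Φ₀)
    (hΦ₀_one : ∀ q : S, Φ₀ (coreProj q * coreIsom 1) = diagProj (.principal q))
    (hΦ₀_ne : ∀ (q : S) (x : Sˣ), x ≠ 1 → Φ₀ (coreProj q * coreIsom x) = 0)
    {B : Type w} [NonUnitalCStarAlgebra B] (π : FullCStar S →⋆ₙₐ[ℂ] B) :
    Function.Injective π ↔ Set.InjOn π (innerCore S) := by
  refine ⟨fun h => h.injOn, fun h => (injective_iff_map_eq_zero π).2 fun a ha => hΦ a ?_⟩
  have hE := innerCoreExpectation_isConditionalExpectation hLCM hC1 ι hι hgen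
  have h1 := norm_expectation_le hLCM hC1 hE (innerCoreExpectation_of_eq hLCM hC1 ι hι hgen)
    (innerCoreExpectation_of_not hLCM hC1 ι hι hgen) hΦ₀ hΦ₀_one hΦ₀_ne π h (star a * a)
  rw [map_mul π, ha, mul_zero, norm_zero, norm_le_zero_iff] at h1
  -- Faithfulness of `Φ₀` is stated for elements `star b * b`, so `E (star a * a)` is first brought
  -- to this form.
  obtain ⟨b, hb⟩ := hE.positive a
  rw [hb] at h1 ⊢
  rw [hΦ₀_faithful b h1, mul_zero]
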